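/- Theorem 2 (Existence of exceed-average phenomenon in a typical case). Let $T,n_0,\alpha>0$. For $P>0$ consider a stationary signal with autocorrelation function $R_X(\tau)=Pe^{-\alpha|\tau|}$, observed on $[0,T]$ in additive white Gaussian noise of power spectral density $n_0/2$. Let $S_X(f)=\int_{-\infty}^{\infty}R_X(\tau)e^{-2\pi i f\tau}\,d\tau$ be its power spectral density, and let $$C_{\mathrm{av}}:=\frac12\int_{-\infty}^{\infty}\log\Bigl(1+\frac{S_X(f)}{n_0/2}\Bigr)\,df$$ be the average rate. (i) For every integer $k\ge1$ there is exactly one $\omega_k>0$ with $2\arctan(\omega_k/\alpha)=k\pi-\omega_kT$. (ii) For every $P>0$ put $\lambda_k=\dfrac{2\alpha P}{\alpha^2+\omega_k^2}$ and $\phi_k(t)=\frac1{Z_k}\bigl(\omega_k\cos(\omega_kt)+\alpha\sin(\omega_kt)\bigr)$, where $Z_k$ is the $L^2([0,T])$ norm of $\omega_k\cos(\omega_k t)+\alpha\sin(\omega_k t)$. These are the Mercer eigenpairs of $R_X$ on $[0,T]$: $\lambda_k>0$, $\int_0^TR_X(s-t)\phi_k(t)\,dt=\lambda_k\phi_k(s)$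 for $s\in[0,T]$, $\int_0^T\phi_i\phi_j\,dt=\delta_{ij}$, and $R_X(s-t)=\sum_{k\ge1}\lambda_k\phi_k(s)\phi_k(t)$ for all $s,t\in[0,T]$. Moreover the series $\sum_{k\ge1}\log\bigl(1+\frac{\lambda_k}{n_0/2}\bigr)$ and the integral defining $C_{\mathrm{av}}$ converge, and $C_{\mathrm{av}}=\frac12\Bigl(\sqrt{\alpha^2+\frac{4P\alpha}{n_0}}-\alpha\Bigr)$. (iii) Let $\psi(x)=(1-e^{-x})/x$ and $$\delta=\frac{n_0\,\alpha\,\psi(2\alpha T)}{\bigl(1-\psi(2\alpha T)\bigr)^2}.$$ Then $\delta>0$, and for every $P$ with $0<P<\delta$ the finite-time rate strictly exceeds the average rate: $$C(T):=\frac1{2T}\sum_{k=1}^{\infty}\log\Bigl(1+\frac{\lambda_k}{n_0/2}\Bigr)>C_{\mathrm{av}}.$$ -/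

import Mathlib

open MeasureTheory
open scoped FourierTransform

noncomputable section

namespace ExceedAverage

/-- The stationary autocorrelation function `R_X(τ) = P exp(-α |τ|)`. -/
def autocorr (P α τ : ℝ) : ℝ := P * Real.exp (-α * |τ|)

/-- `(lam k, φ k)`, `k = 0, 1, 2, …`, is a Mercer expansion on `[0, T]` of the kernel
`K (s, t)`: positive eigenvalues, continuous orthonormal eigenfunctions of the integral operator
with kernel `K`, and the kernel is recovered from them at every point of `[0, T] × [0, T]`
(so that no nonzero eigenvalue is left out). -/
structure IsMercerExpansion (K : ℝ → ℝ → ℝ) (T : ℝ) (lam : ℕ → ℝ) (φ : ℕ → ℝ → ℝ) : Prop where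
  pos : ∀ k, 0 < lam k
  continuousOn : ∀ k, ContinuousOn (φ k) (Set.Icc 0 T)
  eigen : ∀ k, ∀ s ∈ Set.Icc 0 T, ∫ t in (0 : ℝ)..T, K s t * φ k t = lam k * φ k s
  orthonormal : ∀ i j, ∫ t in (0 : ℝ)..T, φ i t * φ j t = if i = j then 1 else 0
  expansion : ∀ s ∈ Set.Icc 0 T, ∀ t ∈ Set.Icc 0 T,
    HasSum (fun k => lam k * φ k s * φ k t) (K s t)

/-- `w` is the `m`-th resonant frequency: `w > 0` and `2 arctan (w / α) = m π - w T`. -/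
def IsResonantFrequency (T α : ℝ) (m : ℕ) (w : ℝ) : Prop :=
  0 < w ∧ 2 * Real.arctan (w / α) = m * Real.pi - w * T

/-- The eigenvalue `2 α P / (α² + w²)` belonging to the resonant frequency `w`. -/
def eigenvalue (P α w : ℝ) : ℝ := 2 * α * P / (α ^ 2 + w ^ 2)

/-- The eigenfunction before normalization. -/
def rawEigenfunction (α w t : ℝ) : ℝ := w * Real.cos (w * t) + α * Real.sin (w * t)

/-- The normalization constant: the `L²` norm on `[0, T]` of the unnormalized eigenfunction. -/
def normConst (T α w : ℝ) : ℝ := Real.sqrt (∫ t in (0 : ℝ)..T, rawEigenfunction α w t ^ 2)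

/-- The normalized eigenfunction. -/
def eigenfunction (T α w t : ℝ) : ℝ := rawEigenfunction α w t / normConst T α w

/-- The finite-time rate `C(T) = (1 / 2T) ∑ₖ log (1 + λₖ / (n₀ / 2))`. -/
def finiteTimeRate (T n₀ : ℝ) (lam : ℕ → ℝ) : ℝ :=
  1 / (2 * T) * ∑' k, Real.log (1 + lam k / (n₀ / 2))

/-- The power spectral density of a stationary process with autocorrelation function `R`: the
Fourier transform `∫ R(τ) exp(-2πi f τ) dτ`, which is real since `R` is real and even. -/
def psd (R : ℝ → ℝ) (f : ℝ) : ℝ := (𝓕 (fun τ : ℝ => (R τ : ℂ)) f).re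

/-- The average rate `½ ∫ log (1 + S_X(f) / S_N(f)) df` for the power spectral densities
`SX` of the signal and `SN` of the noise. -/
def averageRate (SX SN : ℝ → ℝ) : ℝ :=
  1 / 2 * ∫ f : ℝ, Real.log (1 + SX f / SN f)

/-- `ψ(x) = (1 - exp(-x)) / x`. -/
def psi (x : ℝ) : ℝ := (1 - Real.exp (-x)) / x

/-- The power threshold `δ = n₀ α ψ(2αT) / (1 - ψ(2αT))²`. -/
def powerThreshold (T n₀ α : ℝ) : ℝ :=
  n₀ * α * psi (2 * α * T) / (1 - psi (2 * α * T)) ^ 2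

end ExceedAverage

end

/-!
The resonant frequencies are the positive points where the phase `θ(w) = w T + 2 arctan (w / α)`,
an increasing odd bijection of `ℝ`, is a multiple of `π`. The resonance condition is the Robin
boundary condition `r' = -α r` at `T` for `r(t) = w cos (w t) + α sin (w t)`, the condition
`r' = α r` at `0` being automatic. The eigenvalue equation, orthogonality and the norm
`∫ r² = (α² + w²) θ'(w) / 2` follow from explicit antiderivatives.

No theory of compact operators is used for the completeness of the eigenfunctions: the Mercer
series is summed by Poisson's formula. Since the squared norm carries the factor `θ'(w)`, the `k`-th
term is `4 α P F(k)` with `F(x) = g(w) / θ'(w)` at the point `w` where `θ(w) = π x`, for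
`g(w) = r_w(s) r_w(t) / (α² + w²)²`. The substitution `π x = θ(w)` turns the `n`-th Fourier
coefficient of `F` into `π⁻¹ ∫ g(w) exp(-2inθ(w)) dw`. As `exp(iθ(w))` is `exp(iwT)` times the
Blaschke factor `(iα - w) / (iα + w)`, the double pole of `g` at `iα` is cancelled when `n ≠ 0`,
the exponentials do not grow in the upper half-plane for `s, t ∈ [0, T]`, and the contour can be
moved to infinity: the coefficient is zero (`integral_exp_mul_kernelTerm`). The coefficient with
`n = 0` is the Fourier transform of a Cauchy density, which gives `exp(-α |s - t|)`
(`tsum_mercerTerm`, `isMercerExpansion`).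

Integrating the expansion gives the traces `∑ λₖ = P T` and `∑ λₖ² = P² T (1 - ψ(2αT)) / α`. With
`log (1 + z) ≥ 2 z / (2 + z)` and Jensen's inequality for `2 c / (2 + c x)`, `c = 2 / n₀`, these two
numbers bound the finite-time rate from below (`div_le_tsum_log_one_add`). The bound exceeds the
closed form of the average rate exactly when `P` is below the threshold (`half_sqrt_sub_lt_div`).
-/

namespace ExceedAverage

open Filter Topology

/-! ### The phase function and the resonant frequencies -/

/-- The phase `θ(w) = w T + 2 arctan (w / α)`. The resonant frequencies are the positive points
where `θ` is a multiple of `π`. -/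
noncomputable def phase (T α w : ℝ) : ℝ := w * T + 2 * Real.arctan (w / α)

/-- The derivative of `phase T α`. -/
noncomputable def phaseDeriv (T α w : ℝ) : ℝ := T + 2 * α / (α ^ 2 + w ^ 2)

section Phase

variable {T α : ℝ}

lemma phaseDeriv_pos (hT : 0 < T) (hα : 0 < α) (w : ℝ) : 0 < phaseDeriv T α w := by
  unfold phaseDeriv; positivity

lemma continuous_phaseDeriv (hα : 0 < α) : Continuous (phaseDeriv T α) := by
  unfold phaseDeriv
  fun_prop (disch := intros; positivity)

lemma hasDerivAt_phase (hα : 0 < α) (w : ℝ) :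
    HasDerivAt (phase T α) (phaseDeriv T α w) w := by
  have h := ((hasDerivAt_id w).mul_const T).add
    ((((hasDerivAt_id w).div_const α).arctan).const_mul 2)
  refine h.congr_deriv ?_
  unfold phaseDeriv
  simp only [id]
  field_simp

lemma phase_neg (w : ℝ) : phase T α (-w) = -phase T α w := by
  simp only [phase, neg_div, Real.arctan_neg]; ring

lemma phase_zero : phase T α 0 = 0 := by simp [phase]

lemma abs_phase_sub_le (w : ℝ) : |phase T α w - w * T| ≤ Real.pi := by
  rw [phase, add_sub_cancel_left, abs_le]
  constructor <;>
    linarith [Real.arctan_lt_pi_div_two (w / α), Real.neg_pi_div_two_lt_arctan (w / α)]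

lemma strictMono_phase (hT : 0 < T) (hα : 0 < α) : StrictMono (phase T α) :=
  strictMono_of_hasDerivAt_pos (hasDerivAt_phase hα) (phaseDeriv_pos hT hα)

lemma continuous_phase (hα : 0 < α) : Continuous (phase T α) :=
  continuous_iff_continuousAt.2 fun w => (hasDerivAt_phase hα w).continuousAt

lemma surjective_phase (hT : 0 < T) (hα : 0 < α) : Function.Surjective (phase T α) := by
  refine (continuous_phase hα).surjective ?_ ?_
  · refine tendsto_atTop_mono (f := fun w => w * T - Real.pi) (fun w => ?_) ?_
    · linarith [(abs_le.1 (abs_phase_sub_le (T := T) (α := α) w)).1]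
    · exact tendsto_atTop_add_const_right _ _ (tendsto_id.atTop_mul_const hT)
  · refine tendsto_atBot_mono (f := fun w => w * T + Real.pi) (fun w => ?_) ?_
    · linarith [(abs_le.1 (abs_phase_sub_le (T := T) (α := α) w)).2]
    · exact tendsto_atBot_add_const_right _ _ (tendsto_id.atBot_mul_const hT)

/-- The frequency `w` with `θ(w) = π x`; it interpolates the resonant frequencies, which are its
values at the positive integers. -/
noncomputable def freq (hT : 0 < T) (hα : 0 < α) (x : ℝ) : ℝ :=
  ((strictMono_phase hT hα).orderIsoOfSurjective _ (surjective_phase hT hα)).symm (Real.pi * x)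

variable (hT : 0 < T) (hα : 0 < α)

lemma phase_freq (x : ℝ) : phase T α (freq hT hα x) = Real.pi * x :=
  ((strictMono_phase hT hα).orderIsoOfSurjective _ (surjective_phase hT hα)).apply_symm_apply _

lemma freq_eq_of_phase_eq {w x : ℝ} (h : phase T α w = Real.pi * x) : freq hT hα x = w :=
  (strictMono_phase hT hα).injective ((phase_freq hT hα x).trans h.symm)

lemma continuous_freq : Continuous (freq hT hα) :=
  (OrderIso.continuous _).comp (continuous_const.mul continuous_id)

lemma freq_neg (x : ℝ) : freq hT hα (-x) = -freq hT hα x :=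
  freq_eq_of_phase_eq hT hα (by rw [phase_neg, phase_freq]; ring)

lemma freq_zero : freq hT hα 0 = 0 := freq_eq_of_phase_eq hT hα (by simp [phase_zero])

lemma isResonantFrequency_iff {m : ℕ} (hm : 1 ≤ m) {w : ℝ} :
    IsResonantFrequency T α m w ↔ freq hT hα m = w := by
  have hm' : (0 : ℝ) < m := by exact_mod_cast hm
  constructor
  · rintro ⟨-, h⟩
    exact freq_eq_of_phase_eq hT hα (by rw [phase, h]; ring)
  · rintro rfl
    have h := phase_freq hT hα m
    refine ⟨(strictMono_phase hT hα).lt_iff_lt.1 ?_, ?_⟩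
    · rw [phase_zero, h]; positivity
    · rw [phase] at h; linarith

end Phase

/-! ### Contour integrals in the upper half-plane -/

lemma integrable_inv_sq_add_sq {a : ℝ} (ha : 0 < a) :
    Integrable fun x : ℝ => (a ^ 2 + x ^ 2)⁻¹ := by
  have h := (integrable_inv_one_add_sq.comp_div ha.ne').const_mul ((a ^ 2)⁻¹)
  refine h.congr (Eventually.of_forall fun x => ?_)
  simp only
  field_simp

lemma normSq_add_mul_I (x a : ℝ) : ‖(x : ℂ) + a * Complex.I‖ ^ 2 = a ^ 2 + x ^ 2 := by
  rw [← Complex.normSq_eq_norm_sq, Complex.normSq_add_mul_I]; ring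

section Contour

variable {f : ℂ → ℂ} {a M : ℝ}

lemma integrable_of_norm_le_div_sq (ha : 0 < a) (hf : ∀ z : ℂ, 0 ≤ z.im → DifferentiableAt ℂ f z)
    (hM : ∀ z : ℂ, 0 ≤ z.im → ‖f z‖ ≤ M / ‖z + a * Complex.I‖ ^ 2) :
    Integrable fun x : ℝ => f x := by
  refine ((integrable_inv_sq_add_sq ha).const_mul M).mono' ?_ (Eventually.of_forall fun x => ?_)
  · refine Continuous.aestronglyMeasurable (continuous_iff_continuousAt.2 fun x => ?_)
    exact (hf x (by simp)).continuousAt.comp Complex.continuous_ofReal.continuousAt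
  · have := hM x (by simp)
    rwa [normSq_add_mul_I, div_eq_mul_inv] at this

/-- Cauchy's theorem on the squares `[-R, R] × [0, R]`, with `R → ∞`. -/
lemma integral_eq_zero_of_norm_le_div_sq (ha : 0 < a)
    (hf : ∀ z : ℂ, 0 ≤ z.im → DifferentiableAt ℂ f z)
    (hM : ∀ z : ℂ, 0 ≤ z.im → ‖f z‖ ≤ M / ‖z + a * Complex.I‖ ^ 2) :
    ∫ x : ℝ, f x = 0 := by
  have hM0 : 0 ≤ M := by
    have h := (norm_nonneg _).trans (hM 0 (by simp))
    have : (0 : ℝ) < ‖(0 : ℂ) + a * Complex.I‖ ^ 2 := by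
      simp; positivity
    by_contra hneg
    exact absurd h (not_le.2 (div_neg_of_neg_of_pos (not_le.1 hneg) this))
  have hlim := intervalIntegral_tendsto_integral (integrable_of_norm_le_div_sq ha hf hM)
    tendsto_neg_atTop_atBot tendsto_id
  refine tendsto_nhds_unique hlim ?_
  have hsmall : ∀ R : ℝ, 0 < R → ∀ z : ℂ, 0 ≤ z.im → (R ≤ |z.re| ∨ R ≤ z.im) →
      ‖f z‖ ≤ M / R ^ 2 := by
    intro R hR z hz hzR
    refine (hM z hz).trans ?_
    have : R ≤ ‖z + a * Complex.I‖ := by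
      rcases hzR with h | h
      · refine h.trans ?_
        simpa using Complex.abs_re_le_norm (z + a * Complex.I)
      · have h1 := Complex.abs_im_le_norm (z + a * Complex.I)
        simp only [Complex.add_im, Complex.mul_im, Complex.ofReal_re, Complex.I_im, mul_one,
          Complex.ofReal_im, Complex.I_re, mul_zero, add_zero] at h1
        linarith [le_abs_self (z.im + a)]
    gcongr
  refine squeeze_zero_norm' (a := fun R => 4 * M / R) ?_
    (tendsto_const_nhds.div_atTop tendsto_id)
  filter_upwards [eventually_gt_atTop 0] with R hR
  have hrect := Complex.integral_boundary_rect_eq_zero_of_differentiableOn f (-R : ℂ)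
    (R + R * Complex.I) (by
      intro z hz
      refine (hf z ?_).differentiableWithinAt
      have := hz.2
      simp [Set.uIcc_of_le hR.le] at this
      exact this.1)
  simp only [Complex.neg_re, Complex.neg_im, Complex.ofReal_re, Complex.ofReal_im,
    Complex.add_re, Complex.add_im,
    Complex.mul_re, Complex.mul_im, Complex.I_re, Complex.I_im, neg_zero, mul_zero, mul_one,
    Complex.ofReal_zero, zero_mul, add_zero, zero_add, sub_self] at hrect
  have htop : ‖∫ x in (-R)..R, f (x + R * Complex.I)‖ ≤ M / R ^ 2 * |R - -R| := by
    refine intervalIntegral.norm_integral_le_of_norm_le_const fun x _ => ?_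
    exact hsmall R hR _ (by simpa using hR.le) (Or.inr (by simp))
  have hright : ‖∫ y in (0 : ℝ)..R, f (R + y * Complex.I)‖ ≤ M / R ^ 2 * |R - 0| := by
    refine intervalIntegral.norm_integral_le_of_norm_le_const fun y hy => ?_
    rw [Set.uIoc_of_le hR.le] at hy
    exact hsmall R hR _ (by simpa using hy.1.le) (Or.inl (by simp [abs_of_pos hR]))
  have hleft : ‖∫ y in (0 : ℝ)..R, f ((-R : ℝ) + y * Complex.I)‖ ≤ M / R ^ 2 * |R - 0| := by
    refine intervalIntegral.norm_integral_le_of_norm_le_const fun y hy => ?_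
    rw [Set.uIoc_of_le hR.le] at hy
    exact hsmall R hR _ (by simpa using hy.1.le) (Or.inl (by simp [abs_of_pos hR]))
  have heq : ∫ x in (-R)..R, f x = (∫ x in (-R)..R, f (x + R * Complex.I))
      - Complex.I • (∫ y in (0 : ℝ)..R, f (R + y * Complex.I))
      + Complex.I • ∫ y in (0 : ℝ)..R, f ((-R : ℝ) + y * Complex.I) := by
    linear_combination hrect
  change ‖∫ x in (-R)..R, f x‖ ≤ _
  rw [heq]
  refine (norm_add_le _ _).trans ((add_le_add_left (norm_sub_le _ _) _).trans ?_)
  rw [norm_smul, norm_smul, Complex.norm_I, one_mul, one_mul]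
  have e : 4 * M / R = M / R ^ 2 * (2 * R) + M / R ^ 2 * R + M / R ^ 2 * R := by field_simp; ring
  rw [e]
  rw [abs_of_pos (by linarith)] at htop hright hleft
  linarith

end Contour

/-! ### The Fourier transform of the autocorrelation function -/

section Fourier

variable {α : ℝ}

lemma integrable_and_integral_exp_mul_exp_neg_abs (hα : 0 < α) (x : ℝ) :
    Integrable (fun τ : ℝ => Complex.exp ((x * τ : ℝ) * Complex.I) * (Real.exp (-α * |τ|) : ℂ)) ∧
    ∫ τ : ℝ, Complex.exp ((x * τ : ℝ) * Complex.I) * (Real.exp (-α * |τ|) : ℂ) =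
      ((2 * α / (α ^ 2 + x ^ 2) : ℝ) : ℂ) := by
  set F : ℝ → ℂ := fun τ => Complex.exp ((x * τ : ℝ) * Complex.I) * (Real.exp (-α * |τ|) : ℂ)
  have hneg : Set.EqOn F (fun τ : ℝ => Complex.exp ((α + x * Complex.I) * τ)) (Set.Iic 0) := by
    intro τ hτ
    simp only [F]
    rw [abs_of_nonpos hτ, Complex.ofReal_exp, ← Complex.exp_add]
    congr 1; push_cast; ring
  have hpos : Set.EqOn F (fun τ : ℝ => Complex.exp ((-α + x * Complex.I) * τ)) (Set.Ioi 0) := by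
    intro τ hτ
    simp only [F]
    rw [abs_of_pos hτ, Complex.ofReal_exp, ← Complex.exp_add]
    congr 1; push_cast; ring
  have h1 : IntegrableOn F (Set.Iic 0) :=
    (integrableOn_exp_mul_complex_Iic (a := α + x * Complex.I) (by simpa) 0).congr_fun
      hneg.symm measurableSet_Iic
  have h2 : IntegrableOn F (Set.Ioi 0) :=
    (integrableOn_exp_mul_complex_Ioi (a := -α + x * Complex.I) (by simpa) 0).congr_fun
      hpos.symm measurableSet_Ioi
  refine ⟨?_, ?_⟩
  · rw [← integrableOn_univ, ← Set.Iic_union_Ioi (a := (0 : ℝ))]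
    exact h1.union h2
  · rw [← intervalIntegral.integral_Iic_add_Ioi h1 h2, setIntegral_congr_fun measurableSet_Iic hneg,
      setIntegral_congr_fun measurableSet_Ioi hpos,
      integral_exp_mul_complex_Iic (by simpa), integral_exp_mul_complex_Ioi (by simpa)]
    have e1 : (α : ℂ) + x * Complex.I ≠ 0 := fun h => hα.ne' (by simpa using congrArg Complex.re h)
    have e2 : -(α : ℂ) + x * Complex.I ≠ 0 := fun h => hα.ne' (by simpa using congrArg Complex.re h)
    have e3 : (α : ℂ) ^ 2 + x ^ 2 ≠ 0 := by
      have : α ^ 2 + x ^ 2 ≠ 0 := by positivity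
      exact_mod_cast this
    push_cast
    simp only [mul_zero, Complex.exp_zero]
    field_simp
    linear_combination (-2 * α * x ^ 2 : ℂ) * Complex.I_sq

lemma fourier_exp_neg_abs (hα : 0 < α) (f : ℝ) :
    𝓕 (fun τ : ℝ => (Real.exp (-α * |τ|) : ℂ)) f =
      ((2 * α / (α ^ 2 + (2 * Real.pi * f) ^ 2) : ℝ) : ℂ) := by
  have h := (integrable_and_integral_exp_mul_exp_neg_abs hα (-(2 * Real.pi * f))).2
  rw [neg_sq] at h
  rw [← h, Real.fourier_real_eq_integral_exp_smul]
  refine integral_congr_ae (Eventually.of_forall fun τ => ?_)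
  simp only [smul_eq_mul]
  congr 3; push_cast; ring

/-- The Fourier transform of the Cauchy density, by Fourier inversion. -/
lemma integral_exp_div_sq_add_sq (hα : 0 < α) (τ : ℝ) :
    ∫ w : ℝ, Complex.exp ((τ * w : ℝ) * Complex.I) * (((α ^ 2 + w ^ 2)⁻¹ : ℝ) : ℂ) =
      ((Real.pi / α * Real.exp (-α * |τ|) : ℝ) : ℂ) := by
  have hF : 𝓕 (fun τ : ℝ => (Real.exp (-α * |τ|) : ℂ)) = fun f : ℝ =>
      ((2 * α / (α ^ 2 + (2 * Real.pi * f) ^ 2) : ℝ) : ℂ) := funext (fourier_exp_neg_abs hα)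
  have hint : Integrable (fun τ : ℝ => (Real.exp (-α * |τ|) : ℂ)) := by
    simpa using (integrable_and_integral_exp_mul_exp_neg_abs hα 0).1
  have hFint : Integrable (𝓕 (fun τ : ℝ => (Real.exp (-α * |τ|) : ℂ))) := by
    rw [hF]
    have := ((integrable_inv_sq_add_sq hα).comp_mul_left' (R := 2 * Real.pi)
      (by positivity)).const_mul (2 * α)
    exact this.ofReal
  have hinv := congrFun (Continuous.fourierInv_fourier_eq (by fun_prop) hint hFint) τ
  rw [Real.fourierInv_eq', hF] at hinv
  have hsub := Measure.integral_comp_mul_left (fun w : ℝ => Complex.exp ((τ * w : ℝ) * Complex.I) *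
    (((α ^ 2 + w ^ 2)⁻¹ : ℝ) : ℂ)) (2 * Real.pi)
  have hpi := Real.pi_pos
  rw [abs_of_pos (by positivity)] at hsub
  have heq : (∫ v : ℝ, Complex.exp (((2 * Real.pi * inner ℝ v τ : ℝ) : ℂ) * Complex.I) •
      ((2 * α / (α ^ 2 + (2 * Real.pi * v) ^ 2) : ℝ) : ℂ)) = (2 * α : ℂ) *
      ∫ v : ℝ, Complex.exp ((τ * (2 * Real.pi * v) : ℝ) * Complex.I) *
        (((α ^ 2 + (2 * Real.pi * v) ^ 2)⁻¹ : ℝ) : ℂ) := by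
    rw [← integral_const_mul]
    refine integral_congr_ae (Eventually.of_forall fun v => ?_)
    simp only [smul_eq_mul, div_eq_mul_inv, Complex.ofReal_mul (2 * α)]
    have : 2 * Real.pi * inner ℝ v τ = τ * (2 * Real.pi * v) := by
      simp; ring
    rw [this]; push_cast; ring
  rw [heq, hsub] at hinv
  have hα' : (α : ℂ) ≠ 0 := by exact_mod_cast hα.ne'
  have hpi' : (Real.pi : ℂ) ≠ 0 := by exact_mod_cast hpi.ne'
  rw [Complex.ofReal_mul, ← hinv]
  generalize (∫ w : ℝ, Complex.exp ((τ * w : ℝ) * Complex.I) *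
    (((α ^ 2 + w ^ 2)⁻¹ : ℝ) : ℂ)) = J
  simp only [Complex.real_smul]
  push_cast
  field_simp

end Fourier

/-! ### The phase factor and the vanishing integrals -/

section Contour

variable {T α : ℝ}

/-- The integrand `exp(icz) B(z)^m / (z + iα)²` with the Blaschke factor
`B(z) = (iα - z) / (iα + z)`, which is bounded by `1` on the upper half-plane. -/
noncomputable def blaschkeTerm (α c : ℝ) (m : ℕ) (z : ℂ) : ℂ :=
  Complex.exp (c * z * Complex.I) * ((α * Complex.I - z) / (α * Complex.I + z)) ^ m /
    (z + α * Complex.I) ^ 2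

lemma add_mul_I_ne_zero (hα : 0 < α) {z : ℂ} (hz : 0 ≤ z.im) : z + α * Complex.I ≠ 0 := by
  intro h
  have := congrArg Complex.im h
  simp at this
  linarith

lemma differentiableAt_blaschkeTerm (hα : 0 < α) (c : ℝ) (m : ℕ) {z : ℂ} (hz : 0 ≤ z.im) :
    DifferentiableAt ℂ (blaschkeTerm α c m) z := by
  have h := add_mul_I_ne_zero hα hz
  have h' : (α * Complex.I + z : ℂ) ≠ 0 := by rwa [add_comm]
  unfold blaschkeTerm
  fun_prop (disch := first | exact h' | exact pow_ne_zero 2 h)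

lemma norm_blaschkeTerm_le (hα : 0 < α) {c : ℝ} (hc : 0 ≤ c) (m : ℕ) {z : ℂ} (hz : 0 ≤ z.im) :
    ‖blaschkeTerm α c m z‖ ≤ 1 / ‖z + α * Complex.I‖ ^ 2 := by
  have h := add_mul_I_ne_zero hα hz
  rw [blaschkeTerm, norm_div, norm_pow, norm_mul, norm_pow]
  gcongr
  refine mul_le_one₀ ?_ (by positivity) (pow_le_one₀ (by positivity) ?_)
  · rw [Complex.norm_exp, Real.exp_le_one_iff]
    simp
    positivity
  · rw [norm_div]
    refine div_le_one_of_le₀ ?_ (norm_nonneg _)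
    rw [← sq_le_sq₀ (norm_nonneg _) (norm_nonneg _), ← Complex.normSq_eq_norm_sq,
      ← Complex.normSq_eq_norm_sq, Complex.normSq_apply, Complex.normSq_apply]
    simp
    nlinarith [mul_nonneg hα.le hz]

lemma integrable_blaschkeTerm (hα : 0 < α) {c : ℝ} (hc : 0 ≤ c) (m : ℕ) :
    Integrable fun w : ℝ => blaschkeTerm α c m w :=
  integrable_of_norm_le_div_sq hα (fun _ => differentiableAt_blaschkeTerm hα c m)
    (fun _ => norm_blaschkeTerm_le hα hc m)

lemma integral_blaschkeTerm (hα : 0 < α) {c : ℝ} (hc : 0 ≤ c) (m : ℕ) :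
    ∫ w : ℝ, blaschkeTerm α c m w = 0 :=
  integral_eq_zero_of_norm_le_div_sq hα (fun _ => differentiableAt_blaschkeTerm hα c m)
    (fun _ => norm_blaschkeTerm_le hα hc m)

lemma exp_two_arctan_mul_I (x : ℝ) :
    Complex.exp ((2 * Real.arctan x : ℝ) * Complex.I) =
      (1 + x * Complex.I) / (1 - x * Complex.I) := by
  have hx : (1 - x * Complex.I : ℂ) ≠ 0 := fun h => by simpa using congrArg Complex.re h
  have hpos : (0 : ℝ) < 1 + x ^ 2 := by positivity
  have hs : Real.sin (2 * Real.arctan x) = 2 * x / (1 + x ^ 2) := by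
    rw [Real.sin_two_mul, Real.sin_arctan, Real.cos_arctan]
    field_simp
    rw [Real.sq_sqrt hpos.le]
  have hc : Real.cos (2 * Real.arctan x) = (1 - x ^ 2) / (1 + x ^ 2) := by
    rw [Real.cos_two_mul, Real.cos_sq_arctan]
    field_simp; ring
  rw [Complex.exp_mul_I, ← Complex.ofReal_cos, ← Complex.ofReal_sin, hs, hc, eq_div_iff hx]
  have hpos' : (1 + x ^ 2 : ℂ) ≠ 0 := by exact_mod_cast hpos.ne'
  push_cast
  field_simp
  linear_combination (-2 * x ^ 2 : ℂ) * Complex.I_sq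

/-- The phase factor `exp(iθ(w))` is `exp(iwT)` times a Blaschke factor. -/
lemma exp_phase_mul_I (hα : 0 < α) (w : ℝ) :
    Complex.exp ((phase T α w : ℝ) * Complex.I) =
      Complex.exp (T * w * Complex.I) * ((α * Complex.I - w) / (α * Complex.I + w)) := by
  rw [phase, Complex.ofReal_add, add_mul, Complex.exp_add, exp_two_arctan_mul_I]
  have h1 : (α * Complex.I + w : ℂ) ≠ 0 := by
    rw [add_comm]; exact add_mul_I_ne_zero hα (by simp)
  have h2 : (1 - (w / α : ℝ) * Complex.I : ℂ) ≠ 0 := fun h => by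
    simpa using congrArg Complex.re h
  have hα' : (α : ℂ) ≠ 0 := by exact_mod_cast hα.ne'
  congr 1
  · congr 1; push_cast; ring
  · rw [div_eq_div_iff h2 h1]
    push_cast
    field_simp
    linear_combination (2 * w * α : ℂ) * Complex.I_sq

/-- The function `r_w(s) r_w(t) / (α² + w²)²` of `w`, for the unnormalized eigenfunctions `r_w`.
Divided by `phaseDeriv` it gives the terms of the Mercer series, up to the factor `4 α P`. -/
noncomputable def kernelTerm (α s t w : ℝ) : ℝ :=
  rawEigenfunction α w s * rawEigenfunction α w t / (α ^ 2 + w ^ 2) ^ 2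

lemma rawEigenfunction_eq (w t : ℝ) : (rawEigenfunction α w t : ℂ) =
    ((w - α * Complex.I) * Complex.exp (w * t * Complex.I) +
      (w + α * Complex.I) * Complex.exp (-(w * t * Complex.I))) / 2 := by
  have h : -((w : ℂ) * t * Complex.I) = (-((w : ℂ) * t)) * Complex.I := by ring
  rw [rawEigenfunction, h, Complex.exp_mul_I, Complex.exp_mul_I, Complex.cos_neg, Complex.sin_neg]
  push_cast
  linear_combination (α * Complex.sin (w * t) : ℂ) * Complex.I_sq

lemma sq_add_sq_eq_mul (w : ℝ) :
    ((α ^ 2 + w ^ 2 : ℝ) : ℂ) = (w - α * Complex.I) * (w + α * Complex.I) := by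
  push_cast
  linear_combination (α ^ 2 : ℂ) * Complex.I_sq

/-- The term with the double pole at `iα` is the conjugate of one holomorphic in the upper
half-plane; the two others are Fourier integrands of a Cauchy density. -/
lemma kernelTerm_eq_blaschkeTerm (hα : 0 < α) (s t w : ℝ) :
    (kernelTerm α s t w : ℂ) = (blaschkeTerm α (s + t) 0 w +
      starRingEnd ℂ (blaschkeTerm α (s + t) 0 w) +
      Complex.exp (((s - t) * w : ℝ) * Complex.I) * (((α ^ 2 + w ^ 2)⁻¹ : ℝ) : ℂ) +
      Complex.exp (((t - s) * w : ℝ) * Complex.I) * (((α ^ 2 + w ^ 2)⁻¹ : ℝ) : ℂ)) / 4 := by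
  have h1 : (w + α * Complex.I : ℂ) ≠ 0 := add_mul_I_ne_zero hα (by simp)
  have h2 : (w - α * Complex.I : ℂ) ≠ 0 := fun h => hα.ne' (by simpa using congrArg Complex.im h)
  rw [kernelTerm, Complex.ofReal_div, Complex.ofReal_mul, rawEigenfunction_eq, rawEigenfunction_eq,
    Complex.ofReal_pow, Complex.ofReal_inv, sq_add_sq_eq_mul, blaschkeTerm]
  simp only [pow_zero, mul_one, map_div₀, map_pow, map_add, map_mul, ← Complex.exp_conj,
    Complex.conj_ofReal, Complex.conj_I]
  have e1 : Complex.exp ((s + t : ℝ) * w * Complex.I) =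
      Complex.exp (w * s * Complex.I) * Complex.exp (w * t * Complex.I) := by
    rw [← Complex.exp_add]; congr 1; push_cast; ring
  have e2 : Complex.exp ((s + t : ℝ) * w * -Complex.I) =
      Complex.exp (-(w * s * Complex.I)) * Complex.exp (-(w * t * Complex.I)) := by
    rw [← Complex.exp_add]; congr 1; push_cast; ring
  have e3 : Complex.exp (((s - t) * w : ℝ) * Complex.I) =
      Complex.exp (w * s * Complex.I) * Complex.exp (-(w * t * Complex.I)) := by
    rw [← Complex.exp_add]; congr 1; push_cast; ring
  have e4 : Complex.exp (((t - s) * w : ℝ) * Complex.I) =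
      Complex.exp (-(w * s * Complex.I)) * Complex.exp (w * t * Complex.I) := by
    rw [← Complex.exp_add]; congr 1; push_cast; ring
  rw [e1, e2, e3, e4, mul_neg, ← sub_eq_add_neg]
  field_simp
  ring

/-- A positive even power of the phase factor cancels the poles of `kernelTerm` in the upper
half-plane. -/
lemma exp_mul_kernelTerm_eq_blaschkeTerm (hα : 0 < α) (s t w : ℝ) (n : ℕ) :
    Complex.exp ((2 * (n + 1 : ℕ) * phase T α w : ℝ) * Complex.I) * (kernelTerm α s t w : ℂ) =
      (blaschkeTerm α (2 * (n + 1) * T + (s + t)) (2 * n + 2) w +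
        blaschkeTerm α (2 * (n + 1) * T - (s + t)) (2 * n) w -
        blaschkeTerm α (2 * (n + 1) * T + (s - t)) (2 * n + 1) w -
        blaschkeTerm α (2 * (n + 1) * T - (s - t)) (2 * n + 1) w) / 4 := by
  have h1 : (w + α * Complex.I : ℂ) ≠ 0 := add_mul_I_ne_zero hα (by simp)
  have h2 : (w - α * Complex.I : ℂ) ≠ 0 := fun h => hα.ne' (by simpa using congrArg Complex.im h)
  have hE : Complex.exp ((2 * (n + 1 : ℕ) * phase T α w : ℝ) * Complex.I) =
      Complex.exp (2 * (n + 1) * T * w * Complex.I) *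
        ((α * Complex.I - w) / (w + α * Complex.I)) ^ (2 * n + 2) := by
    have : ((2 * (n + 1 : ℕ) * phase T α w : ℝ) * Complex.I : ℂ) =
        ((2 * n + 2 : ℕ) : ℂ) * ((phase T α w : ℝ) * Complex.I) := by push_cast; ring
    rw [this, Complex.exp_nat_mul, exp_phase_mul_I hα, mul_pow, ← Complex.exp_nat_mul,
      add_comm (w : ℂ)]
    congr 2; push_cast; ring
  have hexp : ∀ a b : ℝ, Complex.exp (((a + b : ℝ) : ℂ) * w * Complex.I) =
      Complex.exp (a * w * Complex.I) * Complex.exp (b * w * Complex.I) := fun a b => by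
    rw [← Complex.exp_add]; congr 1; push_cast; ring
  have e0 : Complex.exp (((2 * (n + 1) * T : ℝ) : ℂ) * w * Complex.I) =
      Complex.exp (2 * (n + 1) * T * w * Complex.I) := by push_cast; rfl
  have e2 : Complex.exp ((-(s + t) : ℝ) * w * Complex.I) =
      Complex.exp (-(w * s * Complex.I)) * Complex.exp (-(w * t * Complex.I)) := by
    rw [← Complex.exp_add]; congr 1; push_cast; ring
  have e3 : Complex.exp ((s - t : ℝ) * w * Complex.I) =
      Complex.exp (w * s * Complex.I) * Complex.exp (-(w * t * Complex.I)) := by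
    rw [← Complex.exp_add]; congr 1; push_cast; ring
  have e4 : Complex.exp ((-(s - t) : ℝ) * w * Complex.I) =
      Complex.exp (-(w * s * Complex.I)) * Complex.exp (w * t * Complex.I) := by
    rw [← Complex.exp_add]; congr 1; push_cast; ring
  rw [hE, kernelTerm, Complex.ofReal_div, Complex.ofReal_mul, rawEigenfunction_eq,
    rawEigenfunction_eq, Complex.ofReal_pow, sq_add_sq_eq_mul]
  simp only [blaschkeTerm, sub_eq_add_neg (2 * (n + 1) * T), hexp, e0, e2, e3, e4]
  -- in terms of the Blaschke factor `b`, the conjugate factor is `w - iα = -b (w + iα)`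
  obtain ⟨b, hb⟩ : ∃ b : ℂ, b = (α * Complex.I - w) / (w + α * Complex.I) := ⟨_, rfl⟩
  have hb' : (w - α * Complex.I : ℂ) = -b * (w + α * Complex.I) := by rw [hb]; field_simp; ring
  have hb0 : b ≠ 0 := by
    rintro rfl
    exact h2 (by rw [hb']; ring)
  rw [add_comm (α * Complex.I : ℂ), ← hb, hb', pow_add, pow_add, pow_one]
  field_simp
  ring

end Contour

/-! ### Poisson summation over the resonant frequencies -/

section Poisson

variable {T α s t : ℝ}

lemma integrable_exp_div_sq_add_sq (hα : 0 < α) (τ : ℝ) :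
    Integrable fun w : ℝ =>
      Complex.exp ((τ * w : ℝ) * Complex.I) * (((α ^ 2 + w ^ 2)⁻¹ : ℝ) : ℂ) := by
  refine (integrable_inv_sq_add_sq hα).ofReal.mono' (f := fun w => _) ?_
    (Eventually.of_forall fun w => ?_)
  · refine Continuous.aestronglyMeasurable ?_
    have : ∀ w : ℝ, α ^ 2 + w ^ 2 ≠ 0 := fun w => by positivity
    fun_prop (disch := assumption)
  · rw [norm_mul, Complex.norm_exp_ofReal_mul_I, one_mul, Complex.norm_real, Real.norm_of_nonneg]
    · rfl
    · positivity

lemma integral_kernelTerm (hα : 0 < α) (hs : 0 ≤ s) (ht : 0 ≤ t) :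
    ∫ w : ℝ, (kernelTerm α s t w : ℂ) =
      ((Real.pi / (2 * α) * Real.exp (-α * |s - t|) : ℝ) : ℂ) := by
  have hB := integrable_blaschkeTerm hα (add_nonneg hs ht) 0
  have hBc : Integrable fun w : ℝ => starRingEnd ℂ (blaschkeTerm α (s + t) 0 w) :=
    Complex.conjCLE.toContinuousLinearMap.integrable_comp hB
  have h1 := integrable_exp_div_sq_add_sq hα (s - t)
  have h2 := integrable_exp_div_sq_add_sq hα (t - s)
  simp_rw [kernelTerm_eq_blaschkeTerm hα]
  rw [integral_div, integral_add ((hB.fun_add hBc).fun_add h1) h2, integral_add (hB.fun_add hBc) h1,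
    integral_add hB hBc, integral_conj, integral_blaschkeTerm hα (add_nonneg hs ht),
    integral_exp_div_sq_add_sq hα, integral_exp_div_sq_add_sq hα, abs_sub_comm t s]
  have hα' : (α : ℂ) ≠ 0 := by exact_mod_cast hα.ne'
  push_cast
  simp only [map_zero]
  field_simp
  ring

lemma integral_exp_mul_kernelTerm_succ (hα : 0 < α) (hs : s ∈ Set.Icc 0 T) (ht : t ∈ Set.Icc 0 T)
    (n : ℕ) : ∫ w : ℝ, Complex.exp ((2 * (n + 1 : ℕ) * phase T α w : ℝ) * Complex.I) *
      (kernelTerm α s t w : ℂ) = 0 := by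
  obtain ⟨hs0, hsT⟩ := hs
  obtain ⟨ht0, htT⟩ := ht
  have hn : 0 ≤ 2 * n * T := by have := hs0.trans hsT; positivity
  have c1 : 0 ≤ 2 * (n + 1) * T + (s + t) := by linarith
  have c2 : 0 ≤ 2 * (n + 1) * T - (s + t) := by linarith
  have c3 : 0 ≤ 2 * (n + 1) * T + (s - t) := by linarith
  have c4 : 0 ≤ 2 * (n + 1) * T - (s - t) := by linarith
  have h1 := integrable_blaschkeTerm hα c1 (2 * n + 2)
  have h2 := integrable_blaschkeTerm hα c2 (2 * n)
  have h3 := integrable_blaschkeTerm hα c3 (2 * n + 1)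
  have h4 := integrable_blaschkeTerm hα c4 (2 * n + 1)
  have h123 : Integrable fun w : ℝ => blaschkeTerm α (2 * (n + 1) * T + (s + t)) (2 * n + 2) w +
      blaschkeTerm α (2 * (n + 1) * T - (s + t)) (2 * n) w -
      blaschkeTerm α (2 * (n + 1) * T + (s - t)) (2 * n + 1) w := (h1.add h2).sub h3
  simp_rw [exp_mul_kernelTerm_eq_blaschkeTerm hα]
  rw [integral_div, integral_sub h123 h4, integral_sub (h1.fun_add h2) h3,
    integral_add h1 h2, integral_blaschkeTerm hα c1, integral_blaschkeTerm hα c2,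
    integral_blaschkeTerm hα c3, integral_blaschkeTerm hα c4]
  simp

lemma kernelTerm_neg (w : ℝ) : kernelTerm α s t (-w) = kernelTerm α s t w := by
  simp only [kernelTerm, rawEigenfunction, neg_mul, Real.cos_neg, Real.sin_neg]
  ring

/-- Negative `n` reduce to positive ones by the substitution `w ↦ -w`. -/
lemma integral_exp_mul_kernelTerm (hα : 0 < α) (hs : s ∈ Set.Icc 0 T) (ht : t ∈ Set.Icc 0 T)
    {n : ℤ} (hn : n ≠ 0) : ∫ w : ℝ, Complex.exp ((2 * n * phase T α w : ℝ) * Complex.I) *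
      (kernelTerm α s t w : ℂ) = 0 := by
  obtain ⟨m, rfl | rfl⟩ := n.eq_nat_or_neg
  · obtain ⟨k, rfl⟩ := Nat.exists_eq_succ_of_ne_zero (show m ≠ 0 by simpa using hn)
    simpa using integral_exp_mul_kernelTerm_succ hα hs ht k
  · obtain ⟨k, rfl⟩ := Nat.exists_eq_succ_of_ne_zero (show m ≠ 0 by simpa using hn)
    rw [← integral_exp_mul_kernelTerm_succ hα hs ht k, ← integral_neg_eq_self]
    refine integral_congr_ae (Eventually.of_forall fun w => ?_)
    simp only [kernelTerm_neg, phase_neg]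
    congr 3; push_cast; ring

variable (hT : 0 < T) (hα : 0 < α)

lemma abs_rawEigenfunction_le (hα : 0 < α) (w t : ℝ) :
    |rawEigenfunction α w t| ≤ |w| + α := by
  refine (abs_add_le _ _).trans ?_
  rw [abs_mul, abs_mul, abs_of_pos hα]
  have := mul_le_mul_of_nonneg_left (Real.abs_cos_le_one (w * t)) (abs_nonneg w)
  have := mul_le_mul_of_nonneg_left (Real.abs_sin_le_one (w * t)) hα.le
  linarith

lemma abs_rawEigenfunction_mul_le (hα : 0 < α) (w s t : ℝ) :
    |rawEigenfunction α w s * rawEigenfunction α w t| ≤ 2 * (α ^ 2 + w ^ 2) := by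
  rw [abs_mul]
  refine (mul_le_mul (abs_rawEigenfunction_le hα w s) (abs_rawEigenfunction_le hα w t)
    (abs_nonneg _) (by positivity)).trans ?_
  nlinarith [sq_nonneg (|w| - α), sq_abs w]

/-- The resonant frequencies grow linearly, so that `1 / (α² + w²)` decays quadratically. -/
lemma inv_sq_add_sq_freq_le {x : ℝ} (hx : 2 ≤ |x|) :
    (α ^ 2 + freq hT hα x ^ 2)⁻¹ ≤ (2 * T / Real.pi) ^ 2 * |x| ^ (-2 : ℝ) := by
  have hpi := Real.pi_pos
  have h := abs_phase_sub_le (T := T) (α := α) (freq hT hα x)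
  rw [phase_freq] at h
  have h1 : Real.pi * |x| - |freq hT hα x| * T ≤ Real.pi := by
    refine le_trans ?_ h
    refine le_trans (le_of_eq ?_) (abs_sub_abs_le_abs_sub _ _)
    rw [abs_mul, abs_mul, abs_of_pos hpi, abs_of_pos hT]
  have h2 : Real.pi / (2 * T) * |x| ≤ |freq hT hα x| := by
    rw [div_mul_eq_mul_div, div_le_iff₀ (by positivity)]
    nlinarith
  have hx0 : 0 < |x| := by linarith
  rw [Real.rpow_neg hx0.le, Real.rpow_two]
  have h3 : (Real.pi / (2 * T) * |x|) ^ 2 ≤ α ^ 2 + freq hT hα x ^ 2 := by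
    rw [← sq_abs (freq hT hα x)]
    nlinarith [pow_le_pow_left₀ (by positivity) h2 2, sq_nonneg α]
  refine (inv_anti₀ (by positivity) h3).trans (le_of_eq ?_)
  field_simp

lemma tendsto_abs_cocompact : Tendsto (fun x : ℝ => |x|) (cocompact ℝ) atTop :=
  tendsto_norm_cocompact_atTop

lemma isBigO_inv_sq_add_sq_freq :
    (fun x => (α ^ 2 + freq hT hα x ^ 2)⁻¹) =O[cocompact ℝ] fun x : ℝ => |x| ^ (-2 : ℝ) := by
  refine Asymptotics.IsBigO.of_bound ((2 * T / Real.pi) ^ 2) ?_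
  filter_upwards [tendsto_abs_cocompact.eventually_ge_atTop 2] with x hx
  rw [Real.norm_of_nonneg (by positivity), Real.norm_of_nonneg (by positivity)]
  exact inv_sq_add_sq_freq_le hT hα hx

lemma continuous_kernelTerm (hα : 0 < α) : Continuous (kernelTerm α s t) := by
  have : ∀ w : ℝ, (α ^ 2 + w ^ 2) ^ 2 ≠ 0 := fun w => by positivity
  unfold kernelTerm rawEigenfunction
  fun_prop (disch := assumption)

/-- The summand of the Mercer series without the factor `4 α P`, as a function of a real
index `x`. -/
noncomputable def mercerTerm (s t x : ℝ) : ℝ :=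
  kernelTerm α s t (freq hT hα x) / phaseDeriv T α (freq hT hα x)

lemma continuous_mercerTerm : Continuous (mercerTerm (s := s) (t := t) hT hα) :=
  ((continuous_kernelTerm hα).comp (continuous_freq hT hα)).div
    ((continuous_phaseDeriv hα).comp (continuous_freq hT hα))
    fun _ => (phaseDeriv_pos hT hα _).ne'

lemma abs_mercerTerm_le (x : ℝ) :
    |mercerTerm hT hα s t x| ≤ 2 / T * (α ^ 2 + freq hT hα x ^ 2)⁻¹ := by
  have h1 : T ≤ phaseDeriv T α (freq hT hα x) := by
    unfold phaseDeriv
    have : 0 ≤ 2 * α / (α ^ 2 + freq hT hα x ^ 2) := by positivity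
    linarith
  rw [mercerTerm, kernelTerm, abs_div, abs_div, abs_of_pos (phaseDeriv_pos hT hα _),
    abs_of_pos (by positivity : 0 < (α ^ 2 + freq hT hα x ^ 2) ^ 2)]
  calc _ ≤ 2 * (α ^ 2 + freq hT hα x ^ 2) / (α ^ 2 + freq hT hα x ^ 2) ^ 2 / T := by
        gcongr
        exact abs_rawEigenfunction_mul_le hα _ _ _
    _ = _ := by
        have : α ^ 2 + freq hT hα x ^ 2 ≠ 0 := by positivity
        field_simp

lemma isBigO_mercerTerm :
    (fun x => (mercerTerm hT hα s t x : ℂ)) =O[cocompact ℝ] fun x : ℝ => |x| ^ (-2 : ℝ) := by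
  refine Asymptotics.IsBigO.trans (Asymptotics.IsBigO.of_bound (2 / T) ?_)
    (isBigO_inv_sq_add_sq_freq hT hα)
  refine Eventually.of_forall fun x => ?_
  rw [Complex.norm_real, Real.norm_eq_abs, Real.norm_of_nonneg (by positivity)]
  exact abs_mercerTerm_le hT hα x

/-- The substitution `π x = θ(w)`, whose Jacobian cancels the denominator `θ'(w)`. -/
lemma fourier_mercerTerm (n : ℤ) :
    𝓕 (fun x : ℝ => (mercerTerm hT hα s t x : ℂ)) n = (Real.pi : ℂ)⁻¹ *
      ∫ w : ℝ, Complex.exp ((2 * (-n : ℤ) * phase T α w : ℝ) * Complex.I) *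
        (kernelTerm α s t w : ℂ) := by
  have hpi := Real.pi_pos
  have himage : (fun w => phase T α w / Real.pi) '' Set.univ = Set.univ := by
    rw [Set.image_univ, Set.range_eq_univ]
    intro y
    obtain ⟨w, hw⟩ := surjective_phase hT hα (y * Real.pi)
    exact ⟨w, by simp only [hw]; field_simp⟩
  have hsub := integral_image_eq_integral_abs_deriv_smul (s := Set.univ)
    (f := fun w => phase T α w / Real.pi) (f' := fun w => phaseDeriv T α w / Real.pi)
    MeasurableSet.univ (fun w _ => ((hasDerivAt_phase hα w).div_const _).hasDerivWithinAt)
    (fun v _ w _ h => (strictMono_phase hT hα).injective ((div_left_inj' hpi.ne').1 h))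
    (fun x : ℝ => Complex.exp (↑(-2 * Real.pi * x * n) * Complex.I) • (mercerTerm hT hα s t x : ℂ))
  rw [himage, setIntegral_univ, setIntegral_univ] at hsub
  rw [Real.fourier_real_eq_integral_exp_smul, hsub, ← integral_const_mul]
  refine integral_congr_ae (Eventually.of_forall fun w => ?_)
  have hD := phaseDeriv_pos (T := T) (α := α) hT hα w
  have hw : freq hT hα (phase T α w / Real.pi) = w := freq_eq_of_phase_eq hT hα (by field_simp)
  simp only [mercerTerm, hw, smul_eq_mul, abs_of_pos (div_pos hD hpi), Complex.real_smul]
  have hD' : (phaseDeriv T α w : ℂ) ≠ 0 := by exact_mod_cast hD.ne'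
  have he : -2 * Real.pi * (phase T α w / Real.pi) * n = 2 * (-n : ℤ) * phase T α w := by
    push_cast; field_simp
  rw [he]
  push_cast
  field_simp

lemma summable_mercerTerm :
    Summable fun n : ℤ => (mercerTerm hT hα s t n : ℂ) :=
  summable_of_isBigO (Real.summable_abs_int_rpow one_lt_two)
    ((isBigO_mercerTerm hT hα).comp_tendsto Int.tendsto_coe_cofinite)

/-- Poisson summation: only the zeroth Fourier coefficient of `mercerTerm` survives. -/
lemma tsum_mercerTerm (hs : s ∈ Set.Icc 0 T) (ht : t ∈ Set.Icc 0 T) :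
    ∑' n : ℤ, (mercerTerm hT hα s t n : ℂ) = ((Real.exp (-α * |s - t|) / (2 * α) : ℝ) : ℂ) := by
  have hzero : ∀ n : ℤ, n ≠ 0 → 𝓕 (fun x : ℝ => (mercerTerm hT hα s t x : ℂ)) n = 0 := by
    intro n hn
    rw [fourier_mercerTerm, integral_exp_mul_kernelTerm hα hs ht (neg_ne_zero.2 hn), mul_zero]
  have hP := Real.tsum_eq_tsum_fourier_of_rpow_decay_of_summable
    (Complex.continuous_ofReal.comp (continuous_mercerTerm (s := s) (t := t) hT hα))
    one_lt_two (isBigO_mercerTerm hT hα)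
    (summable_of_ne_finset_zero (s := {0}) fun n hn => hzero n (by simpa using hn)) 0
  simp only [Function.comp_def, zero_add] at hP
  rw [hP, tsum_eq_single 0 fun n hn => by rw [hzero n hn, zero_mul], fourier_mercerTerm]
  have hpi : (Real.pi : ℂ) ≠ 0 := by exact_mod_cast Real.pi_ne_zero
  have hα' : (α : ℂ) ≠ 0 := by exact_mod_cast hα.ne'
  simp only [neg_zero, Int.cast_zero, mul_zero, zero_mul, Complex.ofReal_zero, Complex.exp_zero,
    one_mul, integral_kernelTerm hα hs.1 ht.1, fourier_zero, mul_one]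
  push_cast
  field_simp

/-- The terms are even in the index and vanish at `0`, so that the sum over the positive integers
is half the sum over all integers. -/
lemma hasSum_mercerTerm (hs : s ∈ Set.Icc 0 T) (ht : t ∈ Set.Icc 0 T) :
    HasSum (fun k : ℕ => mercerTerm hT hα s t (k + 1 : ℕ))
      (Real.exp (-α * |s - t|) / (4 * α)) := by
  have hsum : Summable fun n : ℤ => mercerTerm hT hα s t n :=
    Complex.summable_ofReal.1 (summable_mercerTerm hT hα)
  have htsum : ∑' n : ℤ, mercerTerm hT hα s t n = Real.exp (-α * |s - t|) / (2 * α) := by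
    have := tsum_mercerTerm hT hα hs ht
    rw [← Complex.ofReal_tsum] at this
    exact_mod_cast this
  have heven : ∀ x, mercerTerm hT hα s t (-x) = mercerTerm hT hα s t x := fun x => by
    rw [mercerTerm, mercerTerm, freq_neg, kernelTerm_neg, phaseDeriv, phaseDeriv, neg_sq]
  have hzero : mercerTerm hT hα s t 0 = 0 := by
    simp [mercerTerm, kernelTerm, freq_zero, rawEigenfunction]
  have hnat : Summable fun k : ℕ => mercerTerm hT hα s t (k + 1 : ℕ) := by
    have := hsum.comp_injective (i := fun k : ℕ => ((k + 1 : ℕ) : ℤ)) fun a b h => by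
      simpa using h
    simpa [Function.comp_def] using this
  have h2 := HasSum.of_add_one_of_neg_add_one (f := fun n : ℤ => mercerTerm hT hα s t n)
    (m := ∑' k : ℕ, mercerTerm hT hα s t (k + 1 : ℕ))
    (m' := ∑' k : ℕ, mercerTerm hT hα s t (k + 1 : ℕ))
    (by simpa using hnat.hasSum) (by
      have := hnat.hasSum
      simp only [← heven ((_ + 1 : ℕ) : ℝ)] at this ⊢
      simpa using this)
  have h3 := h2.tsum_eq
  simp only [htsum, Int.cast_zero, hzero, add_zero] at h3
  convert hnat.hasSum using 1
  have hα' := hα.ne'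
  field_simp at h3 ⊢
  linarith

end Poisson

/-! ### The boundary value problem solved by the eigenfunctions -/

section Eigenfunction

variable {T α w v s t : ℝ}

/-- The derivative in `t` of `rawEigenfunction α w t`. -/
noncomputable def rawEigenfunctionDeriv (α w t : ℝ) : ℝ :=
  w * (α * Real.cos (w * t) - w * Real.sin (w * t))

lemma hasDerivAt_rawEigenfunction :
    HasDerivAt (rawEigenfunction α w) (rawEigenfunctionDeriv α w t) t := by
  have hc : HasDerivAt (fun t => w * t) w t := by simpa using (hasDerivAt_id t).const_mul w
  refine ((hc.cos.const_mul w).add (hc.sin.const_mul α)).congr_deriv ?_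
  rw [rawEigenfunctionDeriv]; ring

lemma hasDerivAt_rawEigenfunctionDeriv :
    HasDerivAt (rawEigenfunctionDeriv α w) (-w ^ 2 * rawEigenfunction α w t) t := by
  have hc : HasDerivAt (fun t => w * t) w t := by simpa using (hasDerivAt_id t).const_mul w
  refine (((hc.cos.const_mul α).sub (hc.sin.const_mul w)).const_mul w).congr_deriv ?_
  rw [rawEigenfunction]; ring

lemma continuous_rawEigenfunction : Continuous (rawEigenfunction α w) := by
  unfold rawEigenfunction; fun_prop

lemma rawEigenfunction_zero : rawEigenfunction α w 0 = w := by simp [rawEigenfunction]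

lemma rawEigenfunctionDeriv_zero : rawEigenfunctionDeriv α w 0 = α * w := by
  simp [rawEigenfunctionDeriv, mul_comm]

lemma energy_eq : w ^ 2 * rawEigenfunction α w t ^ 2 + rawEigenfunctionDeriv α w t ^ 2 =
    w ^ 2 * (α ^ 2 + w ^ 2) := by
  rw [rawEigenfunction, rawEigenfunctionDeriv]
  linear_combination (w ^ 2 * (α ^ 2 + w ^ 2)) * Real.sin_sq_add_cos_sq (w * t)

/-- The resonance condition is the Robin boundary condition at `T`; the one at `0` holds for
every `w`. -/
lemma IsResonantFrequency.boundary (hα : 0 < α) {m : ℕ} (h : IsResonantFrequency T α m w) :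
    rawEigenfunctionDeriv α w T = -α * rawEigenfunction α w T := by
  have hwT : w * T = m * Real.pi - 2 * Real.arctan (w / α) := by linarith [h.2]
  set a := Real.arctan (w / α) with ha
  have hca : Real.cos a ≠ 0 := (Real.cos_arctan_pos _).ne'
  have hw : w * Real.cos a = α * Real.sin a := by
    have := Real.tan_arctan (w / α)
    rw [← ha, Real.tan_eq_sin_div_cos, div_eq_div_iff hca hα.ne'] at this
    linarith
  have hs : Real.sin (w * T) = -(-1) ^ m * Real.sin (2 * a) := by
    rw [hwT, Real.sin_nat_mul_pi_sub]; ring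
  have hc : Real.cos (w * T) = (-1) ^ m * Real.cos (2 * a) := by
    rw [hwT, Real.cos_nat_mul_pi_sub]
  have key : 2 * α * w * Real.cos (2 * a) + (w ^ 2 - α ^ 2) * Real.sin (2 * a) = 0 := by
    have : (2 * α * w * Real.cos (2 * a) + (w ^ 2 - α ^ 2) * Real.sin (2 * a)) *
        Real.cos a ^ 2 = 0 := by
      rw [Real.sin_two_mul, Real.cos_two_mul']
      have h2 : w ^ 2 * Real.cos a ^ 2 = α ^ 2 * Real.sin a ^ 2 := by
        rw [← mul_pow, hw, mul_pow]
      linear_combination (2 * α * Real.cos a * (Real.cos a ^ 2 - Real.sin a ^ 2)) * hw +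
        (2 * Real.sin a * Real.cos a) * h2
    exact (mul_eq_zero.1 this).resolve_right (pow_ne_zero 2 hca)
  rw [rawEigenfunction, rawEigenfunctionDeriv, hs, hc]
  linear_combination ((-1) ^ m) * key

/-- The antiderivative is `(α² + w²) t / 2 - r r' / (2 w²)`, where `w² r² + r'²` is constant. -/
lemma integral_rawEigenfunction_sq (hw : 0 < w)
    (hb : rawEigenfunctionDeriv α w T = -α * rawEigenfunction α w T) :
    ∫ t in (0 : ℝ)..T, rawEigenfunction α w t ^ 2 = ((α ^ 2 + w ^ 2) * T + 2 * α) / 2 := by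
  have hd : ∀ t, HasDerivAt (fun t => (α ^ 2 + w ^ 2) / 2 * t -
      rawEigenfunction α w t * rawEigenfunctionDeriv α w t / (2 * w ^ 2))
      (rawEigenfunction α w t ^ 2) t := by
    intro t
    refine (((hasDerivAt_id t).const_mul _).sub ((hasDerivAt_rawEigenfunction.mul
      hasDerivAt_rawEigenfunctionDeriv).div_const _)).congr_deriv ?_
    field_simp
    linear_combination -energy_eq (α := α) (w := w) (t := t)
  rw [intervalIntegral.integral_eq_sub_of_hasDerivAt (fun t _ => hd t)
    ((continuous_rawEigenfunction.pow 2).intervalIntegrable _ _), rawEigenfunction_zero,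
    rawEigenfunctionDeriv_zero, hb]
  have hT2 : rawEigenfunction α w T ^ 2 * (α ^ 2 + w ^ 2) = w ^ 2 * (α ^ 2 + w ^ 2) := by
    have := energy_eq (α := α) (w := w) (t := T)
    rw [hb] at this
    linear_combination this
  have hT2' : rawEigenfunction α w T ^ 2 = w ^ 2 := mul_right_cancel₀ (by positivity) hT2
  field_simp
  linear_combination α * hT2'

/-- Orthogonality from the Wronskian, which vanishes at both ends. -/
lemma integral_rawEigenfunction_mul (hw : 0 < w) (hv : 0 < v) (hwv : w ≠ v)
    (hbw : rawEigenfunctionDeriv α w T = -α * rawEigenfunction α w T)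
    (hbv : rawEigenfunctionDeriv α v T = -α * rawEigenfunction α v T) :
    ∫ t in (0 : ℝ)..T, rawEigenfunction α w t * rawEigenfunction α v t = 0 := by
  have hd : ∀ t, HasDerivAt (fun t => rawEigenfunction α w t * rawEigenfunctionDeriv α v t -
      rawEigenfunctionDeriv α w t * rawEigenfunction α v t)
      ((w ^ 2 - v ^ 2) * (rawEigenfunction α w t * rawEigenfunction α v t)) t := by
    intro t
    refine ((hasDerivAt_rawEigenfunction.mul hasDerivAt_rawEigenfunctionDeriv).sub
      (hasDerivAt_rawEigenfunctionDeriv.mul hasDerivAt_rawEigenfunction)).congr_deriv ?_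
    ring
  have hint := intervalIntegral.integral_eq_sub_of_hasDerivAt (a := 0) (b := T) (fun t _ => hd t)
    ((continuous_const.mul
      (continuous_rawEigenfunction.mul continuous_rawEigenfunction)).intervalIntegrable _ _)
  rw [intervalIntegral.integral_const_mul, hbw, hbv, rawEigenfunctionDeriv_zero,
    rawEigenfunctionDeriv_zero, rawEigenfunction_zero, rawEigenfunction_zero] at hint
  have hne : w ^ 2 - v ^ 2 ≠ 0 := by
    rw [sq_sub_sq]
    exact mul_ne_zero (by positivity) (sub_ne_zero.2 hwv)
  refine (mul_eq_zero.1 (hint.trans ?_)).resolve_left hne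
  ring

/-- On `[0, s]` and `[s, T]` the integrand has antiderivatives proportional to
`exp(-α (s - t)) (α r - r')` and `exp(-α (t - s)) (α r + r')`. The boundary conditions annihilate
them at `0` and at `T`. -/
lemma integral_exp_mul_rawEigenfunction (hα : 0 < α) (hs : s ∈ Set.Icc 0 T)
    (hb : rawEigenfunctionDeriv α w T = -α * rawEigenfunction α w T) :
    ∫ t in (0 : ℝ)..T, Real.exp (-α * |s - t|) * rawEigenfunction α w t =
      2 * α / (α ^ 2 + w ^ 2) * rawEigenfunction α w s := by
  have hcont : Continuous fun t => Real.exp (-α * |s - t|) * rawEigenfunction α w t := by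
    have := continuous_rawEigenfunction (α := α) (w := w)
    fun_prop
  have hcont1 : Continuous fun t => Real.exp (-α * (s - t)) * rawEigenfunction α w t := by
    have := continuous_rawEigenfunction (α := α) (w := w)
    fun_prop
  have hcont2 : Continuous fun t => Real.exp (-α * (t - s)) * rawEigenfunction α w t := by
    have := continuous_rawEigenfunction (α := α) (w := w)
    fun_prop
  have hne : α ^ 2 + w ^ 2 ≠ 0 := by positivity
  have hd1 : ∀ t, HasDerivAt (fun t => Real.exp (-α * (s - t)) *
      ((α * rawEigenfunction α w t - rawEigenfunctionDeriv α w t) / (α ^ 2 + w ^ 2)))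
      (Real.exp (-α * (s - t)) * rawEigenfunction α w t) t := by
    intro t
    refine ((((hasDerivAt_id t).const_sub s).const_mul (-α)).exp.mul
      (((hasDerivAt_rawEigenfunction.const_mul α).sub
        hasDerivAt_rawEigenfunctionDeriv).div_const _)).congr_deriv ?_
    simp only [id, Pi.sub_apply]
    field_simp
    ring
  have hd2 : ∀ t, HasDerivAt (fun t => Real.exp (-α * (t - s)) *
      (-(α * rawEigenfunction α w t + rawEigenfunctionDeriv α w t) / (α ^ 2 + w ^ 2)))
      (Real.exp (-α * (t - s)) * rawEigenfunction α w t) t := by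
    intro t
    refine ((((hasDerivAt_id t).sub_const s).const_mul (-α)).exp.mul
      (((hasDerivAt_rawEigenfunction.const_mul α).add
        hasDerivAt_rawEigenfunctionDeriv).neg.div_const _)).congr_deriv ?_
    simp only [id, Pi.add_apply, Pi.neg_apply]
    field_simp
    ring
  rw [← intervalIntegral.integral_add_adjacent_intervals (hcont.intervalIntegrable 0 s)
    (hcont.intervalIntegrable s T),
    intervalIntegral.integral_congr (b := s)
      (g := fun t => Real.exp (-α * (s - t)) * rawEigenfunction α w t) ?_,
    intervalIntegral.integral_congr (a := s)
      (g := fun t => Real.exp (-α * (t - s)) * rawEigenfunction α w t) ?_,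
    intervalIntegral.integral_eq_sub_of_hasDerivAt (fun t _ => hd1 t)
      (hcont1.intervalIntegrable _ _),
    intervalIntegral.integral_eq_sub_of_hasDerivAt (fun t _ => hd2 t)
      (hcont2.intervalIntegrable _ _), hb, rawEigenfunction_zero, rawEigenfunctionDeriv_zero]
  · simp only [sub_self, mul_zero, Real.exp_zero]
    field_simp
    ring
  · intro t ht
    rw [Set.uIcc_of_le hs.2] at ht
    simp only
    rw [abs_sub_comm, abs_of_nonneg (sub_nonneg.2 ht.1)]
  · intro t ht
    rw [Set.uIcc_of_le hs.1] at ht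
    simp only
    rw [abs_of_nonneg (sub_nonneg.2 ht.2)]

end Eigenfunction

/-! ### The Mercer expansion -/

section Mercer

variable {T α P w : ℝ} {ω : ℕ → ℝ}

lemma IsResonantFrequency.normConst_sq (hT : 0 < T) (hα : 0 < α) {m : ℕ}
    (h : IsResonantFrequency T α m w) :
    normConst T α w ^ 2 = ((α ^ 2 + w ^ 2) * T + 2 * α) / 2 := by
  rw [normConst, Real.sq_sqrt, integral_rawEigenfunction_sq h.1 (h.boundary hα)]
  exact intervalIntegral.integral_nonneg hT.le fun _ _ => sq_nonneg _

lemma eq_freq (hT : 0 < T) (hα : 0 < α) (hω : ∀ k, IsResonantFrequency T α (k + 1) (ω k)) (k : ℕ) :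
    ω k = freq hT hα (k + 1 : ℕ) :=
  ((isResonantFrequency_iff hT hα (by omega)).1 (hω k)).symm

lemma eigenvalue_pos (hα : 0 < α) (hP : 0 < P) (w : ℝ) : 0 < eigenvalue P α w := by
  unfold eigenvalue; positivity

lemma isMercerExpansion (hT : 0 < T) (hα : 0 < α) (hP : 0 < P)
    (hω : ∀ k, IsResonantFrequency T α (k + 1) (ω k)) :
    IsMercerExpansion (fun s t => autocorr P α (s - t)) T (fun k => eigenvalue P α (ω k))
      (fun k => eigenfunction T α (ω k)) where
  pos k := eigenvalue_pos hα hP _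
  continuousOn k := (continuous_rawEigenfunction.div_const _).continuousOn
  eigen k s hs := by
    have h := integral_exp_mul_rawEigenfunction hα hs ((hω k).boundary hα)
    have e : ∀ t, autocorr P α (s - t) * eigenfunction T α (ω k) t = P / normConst T α (ω k) *
        (Real.exp (-α * |s - t|) * rawEigenfunction α (ω k) t) := fun t => by
      rw [autocorr, eigenfunction]; ring
    simp_rw [e]
    rw [intervalIntegral.integral_const_mul, h, eigenvalue, eigenfunction]
    ring
  orthonormal i j := by
    have e : ∀ t, eigenfunction T α (ω i) t * eigenfunction T α (ω j) t =
        (normConst T α (ω i) * normConst T α (ω j))⁻¹ *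
        (rawEigenfunction α (ω i) t * rawEigenfunction α (ω j) t) := fun t => by
      rw [eigenfunction, eigenfunction, mul_inv]; ring
    simp_rw [e]
    rw [intervalIntegral.integral_const_mul]
    split_ifs with hij
    · subst hij
      simp_rw [← sq]
      rw [(hω i).normConst_sq hT hα,
        integral_rawEigenfunction_sq (hω i).1 ((hω i).boundary hα)]
      refine inv_mul_cancel₀ ?_
      positivity
    · rw [integral_rawEigenfunction_mul (hω i).1 (hω j).1 ?_ ((hω i).boundary hα)
        ((hω j).boundary hα), mul_zero]
      intro h
      refine hij ?_
      have h' := congrArg (phase T α) h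
      rw [eq_freq hT hα hω, eq_freq hT hα hω, phase_freq, phase_freq] at h'
      have := mul_left_cancel₀ Real.pi_ne_zero h'
      have : i + 1 = j + 1 := by exact_mod_cast this
      omega
  expansion s hs t ht := by
    have hval : autocorr P α (s - t) = 4 * α * P * (Real.exp (-α * |s - t|) / (4 * α)) := by
      rw [autocorr]; field_simp
    simp only [hval]
    refine ((hasSum_mercerTerm hT hα hs ht).mul_left (4 * α * P)).congr_fun fun k => ?_
    have hZ := (hω k).normConst_sq hT hα
    simp only [eigenfunction, eigenvalue, mercerTerm, ← eq_freq hT hα hω, kernelTerm, phaseDeriv]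
    rw [mul_assoc, div_mul_div_comm, ← sq, hZ]
    have : α ^ 2 + ω k ^ 2 ≠ 0 := by positivity
    have : (α ^ 2 + ω k ^ 2) * T + 2 * α ≠ 0 := by positivity
    have : T * (α ^ 2 + ω k ^ 2) + 2 * α ≠ 0 := by positivity
    field_simp
    ring

lemma summable_eigenvalue (hT : 0 < T) (hα : 0 < α)
    (hω : ∀ k, IsResonantFrequency T α (k + 1) (ω k)) :
    Summable fun k => eigenvalue P α (ω k) := by
  have h : Summable fun n : ℤ => (α ^ 2 + freq hT hα n ^ 2)⁻¹ :=
    summable_of_isBigO (Real.summable_abs_int_rpow one_lt_two)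
      ((isBigO_inv_sq_add_sq_freq hT hα).comp_tendsto Int.tendsto_coe_cofinite)
  have h' := (h.comp_injective (i := fun k : ℕ => ((k + 1 : ℕ) : ℤ)) fun a b h => by
    simpa using h).mul_left (2 * α * P)
  refine h'.congr fun k => ?_
  rw [eigenvalue, eq_freq hT hα hω k, div_eq_mul_inv]
  simp

lemma abs_eigenfunction_le (hT : 0 < T) (hα : 0 < α) {m : ℕ} (h : IsResonantFrequency T α m w)
    (t : ℝ) : |eigenfunction T α w t| ≤ Real.sqrt (4 / T) := by
  refine Real.abs_le_sqrt ?_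
  have h1 := abs_rawEigenfunction_mul_le hα w t t
  rw [abs_mul_self] at h1
  rw [eigenfunction, div_pow, h.normConst_sq hT hα, div_le_div_iff₀ (by positivity) hT]
  nlinarith

end Mercer

/-! ### The trace identities -/

namespace IsMercerExpansion

variable {K : ℝ → ℝ → ℝ} {T B C : ℝ} {lam : ℕ → ℝ} {φ : ℕ → ℝ → ℝ}

/-- The sum of the eigenvalues is the trace of the kernel. -/
lemma hasSum_integral_diag (h : IsMercerExpansion K T lam φ) (hT : 0 < T) (hlam : Summable lam)
    (hφ : ∀ k, ∀ t ∈ Set.Icc 0 T, |φ k t| ≤ C) :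
    HasSum lam (∫ t in (0 : ℝ)..T, K t t) := by
  have hI : Set.uIoc 0 T ⊆ Set.Icc 0 T := by
    rw [Set.uIoc_of_le hT.le]; exact Set.Ioc_subset_Icc_self
  have key := intervalIntegral.hasSum_integral_of_dominated_convergence (μ := volume) (a := 0)
    (b := T) (F := fun k t => lam k * φ k t * φ k t) (f := fun t => K t t)
    (fun k _ => lam k * (C * C)) ?_ ?_ ?_ ?_ ?_
  · refine key.congr_fun fun k => Eq.symm ?_
    simp_rw [mul_assoc]
    rw [intervalIntegral.integral_const_mul, h.orthonormal, if_pos rfl, mul_one]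
  · intro k
    refine ContinuousOn.aestronglyMeasurable ?_ measurableSet_uIoc
    exact ((continuousOn_const.mul (h.continuousOn k)).mul (h.continuousOn k)).mono hI
  · refine fun k => Eventually.of_forall fun t ht => ?_
    rw [mul_assoc, norm_mul, norm_mul, Real.norm_of_nonneg (h.pos k).le]
    have := hφ k t (hI ht)
    have hC := (abs_nonneg _).trans this
    have := (h.pos k).le
    simp only [Real.norm_eq_abs]
    gcongr
  · exact Eventually.of_forall fun t _ => hlam.mul_right _
  · exact intervalIntegrable_const
  · exact Eventually.of_forall fun t ht => h.expansion t (hI ht) t (hI ht)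

/-- The sum of the squared eigenvalues is the squared `L²` norm of the kernel: multiply the
expansion by `K s t`, integrate in `t` by the eigenvalue equation, then in `s`. -/
lemma hasSum_sq_integral (h : IsMercerExpansion K T lam φ) (hT : 0 < T) (hlam : Summable lam)
    (hφ : ∀ k, ∀ t ∈ Set.Icc 0 T, |φ k t| ≤ C) (hK : ∀ s, Continuous (K s))
    (hB : ∀ s t, |K s t| ≤ B) :
    HasSum (fun k => lam k ^ 2) (∫ s in (0 : ℝ)..T, ∫ t in (0 : ℝ)..T, K s t ^ 2) := by
  have hI : Set.uIoc 0 T ⊆ Set.Icc 0 T := by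
    rw [Set.uIoc_of_le hT.le]; exact Set.Ioc_subset_Icc_self
  have hC : 0 ≤ C := (abs_nonneg _).trans (hφ 0 0 ⟨le_rfl, hT.le⟩)
  have hinner : ∀ s ∈ Set.Icc 0 T,
      HasSum (fun k => lam k ^ 2 * φ k s ^ 2) (∫ t in (0 : ℝ)..T, K s t ^ 2) := by
    intro s hs
    have key := intervalIntegral.hasSum_integral_of_dominated_convergence (μ := volume) (a := 0)
      (b := T) (F := fun k t => lam k * φ k s * φ k t * K s t) (f := fun t => K s t ^ 2)
      (fun k _ => lam k * (C * C * B)) ?_ ?_ ?_ ?_ ?_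
    · refine key.congr_fun fun k => Eq.symm ?_
      have e : ∀ t, lam k * φ k s * φ k t * K s t = lam k * φ k s * (K s t * φ k t) :=
        fun t => by ring
      simp_rw [e]
      rw [intervalIntegral.integral_const_mul, h.eigen k s hs]
      ring
    · intro k
      refine ContinuousOn.aestronglyMeasurable ?_ measurableSet_uIoc
      exact ((continuousOn_const.mul (h.continuousOn k)).mul (hK s).continuousOn).mono hI
    · refine fun k => Eventually.of_forall fun t ht => ?_
      have h1 := hφ k t (hI ht)
      have h2 := hφ k s hs
      have h3 := (h.pos k).le
      have h4 := hB s t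
      have h5 := (abs_nonneg _).trans h4
      rw [norm_mul, norm_mul, norm_mul, Real.norm_of_nonneg h3]
      simp only [Real.norm_eq_abs]
      calc lam k * |φ k s| * |φ k t| * |K s t| ≤ lam k * C * C * B := by gcongr
        _ = _ := by ring
    · exact Eventually.of_forall fun t _ => hlam.mul_right _
    · exact intervalIntegrable_const
    · refine Eventually.of_forall fun t ht => ?_
      simpa only [sq] using (h.expansion s hs t (hI ht)).mul_right (K s t)
  have hlam2 : Summable fun k => lam k ^ 2 := by
    refine (hlam.mul_left (∑' i, lam i)).of_nonneg_of_le (fun k => sq_nonneg _) fun k => ?_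
    rw [sq]
    exact mul_le_mul_of_nonneg_right (hlam.le_tsum k fun i _ => (h.pos i).le) (h.pos k).le
  have key := intervalIntegral.hasSum_integral_of_dominated_convergence (μ := volume) (a := 0)
    (b := T) (F := fun k s => lam k ^ 2 * φ k s ^ 2) (f := fun s => ∫ t in (0 : ℝ)..T, K s t ^ 2)
    (fun k _ => lam k ^ 2 * C ^ 2) ?_ ?_ ?_ ?_ ?_
  · refine key.congr_fun fun k => Eq.symm ?_
    simp_rw [sq (φ k _)]
    rw [intervalIntegral.integral_const_mul, h.orthonormal, if_pos rfl, mul_one]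
  · intro k
    refine ContinuousOn.aestronglyMeasurable ?_ measurableSet_uIoc
    exact (continuousOn_const.mul ((h.continuousOn k).pow 2)).mono hI
  · refine fun k => Eventually.of_forall fun s hs => ?_
    rw [norm_mul, norm_pow, norm_pow, Real.norm_of_nonneg (h.pos k).le]
    have := hφ k s (hI hs)
    simp only [Real.norm_eq_abs]
    gcongr
  · exact Eventually.of_forall fun t _ => hlam2.mul_right _
  · exact intervalIntegrable_const
  · exact Eventually.of_forall fun s hs => hinner s (hI hs)

end IsMercerExpansion

/-! ### The average rate -/

section AverageRate

variable {α β n₀ P : ℝ}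

lemma psd_autocorr (hα : 0 < α) (f : ℝ) :
    psd (autocorr P α) f = 2 * α * P / (α ^ 2 + (2 * Real.pi * f) ^ 2) := by
  have h : 𝓕 (fun τ : ℝ => (autocorr P α τ : ℂ)) f =
      P * 𝓕 (fun τ : ℝ => (Real.exp (-α * |τ|) : ℂ)) f := by
    rw [Real.fourier_real_eq_integral_exp_smul, Real.fourier_real_eq_integral_exp_smul,
      ← integral_const_mul]
    refine integral_congr_ae (Eventually.of_forall fun τ => ?_)
    simp only [autocorr, smul_eq_mul, Complex.ofReal_mul]
    ring
  rw [psd, h, fourier_exp_neg_abs hα, ← Complex.ofReal_mul, Complex.ofReal_re]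
  ring

lemma integrable_log_one_add_div (hα : 0 < α) {d : ℝ} (hd : 0 ≤ d) :
    Integrable fun x : ℝ => Real.log (1 + d / (α ^ 2 + x ^ 2)) := by
  refine ((integrable_inv_sq_add_sq hα).const_mul d).mono' ?_ (Eventually.of_forall fun x => ?_)
  · refine Continuous.aestronglyMeasurable ?_
    have h1 : ∀ x : ℝ, α ^ 2 + x ^ 2 ≠ 0 := fun x => by positivity
    have h2 : ∀ x : ℝ, 1 + d / (α ^ 2 + x ^ 2) ≠ 0 := fun x => by positivity
    fun_prop (disch := assumption)
  · have h : 0 ≤ d / (α ^ 2 + x ^ 2) := by positivity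
    rw [Real.norm_of_nonneg (Real.log_nonneg (by linarith)), ← div_eq_mul_inv]
    linarith [Real.log_le_sub_one_of_pos (by linarith : 0 < 1 + d / (α ^ 2 + x ^ 2))]

/-- The integrand has the antiderivative
`x log ((β² + x²) / (α² + x²)) + 2 β arctan (x / β) - 2 α arctan (x / α)`. -/
lemma integral_log_one_add_div (hα : 0 < α) (hαβ : α ≤ β) :
    ∫ x : ℝ, Real.log (1 + (β ^ 2 - α ^ 2) / (α ^ 2 + x ^ 2)) = 2 * Real.pi * (β - α) := by
  have hβ : 0 < β := hα.trans_le hαβ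
  set d := β ^ 2 - α ^ 2 with hd_def
  have hd : 0 ≤ d := by rw [hd_def]; nlinarith
  have hderiv : ∀ x : ℝ, HasDerivAt (fun x => x * Real.log (1 + d / (α ^ 2 + x ^ 2)) +
      (2 * β * Real.arctan (x / β) - 2 * α * Real.arctan (x / α)))
      (Real.log (1 + d / (α ^ 2 + x ^ 2))) x := by
    intro x
    have h1 : α ^ 2 + x ^ 2 ≠ 0 := by positivity
    have h2 : 1 + d / (α ^ 2 + x ^ 2) ≠ 0 := by positivity
    have h3 : β ^ 2 + x ^ 2 ≠ 0 := by positivity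
    have h4 : 1 + d / (α ^ 2 + x ^ 2) = (β ^ 2 + x ^ 2) / (α ^ 2 + x ^ 2) := by
      rw [hd_def]; field_simp; ring
    have hq : HasDerivAt (fun x : ℝ => α ^ 2 + x ^ 2) (2 * x) x := by
      simpa using (hasDerivAt_pow 2 x).const_add (α ^ 2)
    have hl : HasDerivAt (fun x : ℝ => 1 + d / (α ^ 2 + x ^ 2))
        (-(d * (2 * x)) / (α ^ 2 + x ^ 2) ^ 2) x := by
      simpa using ((hasDerivAt_const x d).div hq h1).const_add 1
    refine (((hasDerivAt_id x).mul (hl.log h2)).add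
      (((((hasDerivAt_id x).div_const β).arctan).const_mul (2 * β)).sub
        ((((hasDerivAt_id x).div_const α).arctan).const_mul (2 * α)))).congr_deriv ?_
    simp only [id]
    rw [h4, hd_def]
    field_simp
    ring
  have hsmall : ∀ x : ℝ, ‖x * Real.log (1 + d / (α ^ 2 + x ^ 2))‖ ≤ d / |x| := by
    intro x
    rcases eq_or_ne x 0 with rfl | hx
    · simp
    have hx' : 0 < |x| := abs_pos.2 hx
    have h : 0 ≤ d / (α ^ 2 + x ^ 2) := by positivity
    have hlog : Real.log (1 + d / (α ^ 2 + x ^ 2)) ≤ d / (α ^ 2 + x ^ 2) := by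
      linarith [Real.log_le_sub_one_of_pos (by linarith : 0 < 1 + d / (α ^ 2 + x ^ 2))]
    rw [norm_mul, Real.norm_of_nonneg (Real.log_nonneg (by linarith)), Real.norm_eq_abs]
    calc |x| * Real.log (1 + d / (α ^ 2 + x ^ 2)) ≤ |x| * (d / |x| ^ 2) := by
          gcongr
          refine hlog.trans ?_
          rw [sq_abs]
          gcongr
          nlinarith [sq_nonneg α]
      _ = d / |x| := by field_simp
  have hbot : Tendsto (fun x => x * Real.log (1 + d / (α ^ 2 + x ^ 2)) +
      (2 * β * Real.arctan (x / β) - 2 * α * Real.arctan (x / α))) atBot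
      (𝓝 (0 + (2 * β * -(Real.pi / 2) - 2 * α * -(Real.pi / 2)))) := by
    refine Tendsto.add (squeeze_zero_norm hsmall
      (tendsto_const_nhds.div_atTop tendsto_abs_atBot_atTop)) (Tendsto.sub ?_ ?_)
    · exact ((tendsto_nhds_of_tendsto_nhdsWithin Real.tendsto_arctan_atBot).comp
        (tendsto_id.atBot_div_const hβ)).const_mul _
    · exact ((tendsto_nhds_of_tendsto_nhdsWithin Real.tendsto_arctan_atBot).comp
        (tendsto_id.atBot_div_const hα)).const_mul _
  have htop : Tendsto (fun x => x * Real.log (1 + d / (α ^ 2 + x ^ 2)) +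
      (2 * β * Real.arctan (x / β) - 2 * α * Real.arctan (x / α))) atTop
      (𝓝 (0 + (2 * β * (Real.pi / 2) - 2 * α * (Real.pi / 2)))) := by
    refine Tendsto.add (squeeze_zero_norm hsmall
      (tendsto_const_nhds.div_atTop tendsto_abs_atTop_atTop)) (Tendsto.sub ?_ ?_)
    · exact ((tendsto_nhds_of_tendsto_nhdsWithin Real.tendsto_arctan_atTop).comp
        (tendsto_id.atTop_div_const hβ)).const_mul _
    · exact ((tendsto_nhds_of_tendsto_nhdsWithin Real.tendsto_arctan_atTop).comp
        (tendsto_id.atTop_div_const hα)).const_mul _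
  rw [integral_of_hasDerivAt_of_tendsto hderiv (integrable_log_one_add_div hα hd) hbot htop]
  ring

lemma log_psd_eq (hα : 0 < α) (hn₀ : 0 < n₀) (f : ℝ) :
    Real.log (1 + psd (autocorr P α) f / (n₀ / 2)) =
      Real.log (1 + (4 * P * α / n₀) / (α ^ 2 + (2 * Real.pi * f) ^ 2)) := by
  rw [psd_autocorr hα]
  congr 2
  have : α ^ 2 + (2 * Real.pi * f) ^ 2 ≠ 0 := by positivity
  field_simp
  ring

lemma integrable_log_psd (hα : 0 < α) (hn₀ : 0 < n₀) (hP : 0 < P) :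
    Integrable fun f => Real.log (1 + psd (autocorr P α) f / (n₀ / 2)) := by
  simp_rw [log_psd_eq hα hn₀]
  exact (integrable_log_one_add_div hα (d := 4 * P * α / n₀) (by positivity)).comp_mul_left'
    (R := 2 * Real.pi) (by positivity)

lemma averageRate_eq (hα : 0 < α) (hn₀ : 0 < n₀) (hP : 0 < P) :
    averageRate (psd (autocorr P α)) (fun _ => n₀ / 2) =
      1 / 2 * (Real.sqrt (α ^ 2 + 4 * P * α / n₀) - α) := by
  have hd : 0 < 4 * P * α / n₀ := by positivity
  set β := Real.sqrt (α ^ 2 + 4 * P * α / n₀) with hβ_def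
  have hβ2 : β ^ 2 - α ^ 2 = 4 * P * α / n₀ := by
    rw [hβ_def, Real.sq_sqrt (by positivity)]; ring
  have hαβ : α ≤ β := Real.le_sqrt_of_sq_le (by linarith)
  rw [averageRate]
  simp_rw [log_psd_eq hα hn₀]
  rw [← hβ2]
  have hsub := Measure.integral_comp_mul_left
    (fun x : ℝ => Real.log (1 + (β ^ 2 - α ^ 2) / (α ^ 2 + x ^ 2))) (2 * Real.pi)
  have hpi := Real.pi_pos
  rw [hsub, integral_log_one_add_div hα hαβ, abs_of_pos (by positivity), smul_eq_mul]
  field_simp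

end AverageRate

/-! ### The finite-time rate -/

section FiniteTimeRate

variable {T α n₀ P : ℝ} {ω : ℕ → ℝ}

lemma psi_pos {x : ℝ} (hx : 0 < x) : 0 < psi x :=
  div_pos (sub_pos.2 (Real.exp_lt_one_iff.2 (neg_lt_zero.2 hx))) hx

lemma psi_lt_one {x : ℝ} (hx : 0 < x) : psi x < 1 := by
  rw [psi, div_lt_one hx]
  linarith [Real.add_one_lt_exp (x := -x) (by linarith)]

lemma powerThreshold_pos (hT : 0 < T) (hn₀ : 0 < n₀) (hα : 0 < α) :
    0 < powerThreshold T n₀ α := by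
  have h1 := psi_pos (show 0 < 2 * α * T by positivity)
  have h2 := sub_pos.2 (psi_lt_one (show 0 < 2 * α * T by positivity))
  unfold powerThreshold
  positivity

lemma integral_exp_neg_mul (a : ℝ) (ha : a ≠ 0) (s : ℝ) :
    ∫ t in (0 : ℝ)..s, Real.exp (-a * t) = (1 - Real.exp (-a * s)) / a := by
  have hd : ∀ t, HasDerivAt (fun t => -Real.exp (-a * t) / a) (Real.exp (-a * t)) t := by
    intro t
    refine ((((hasDerivAt_id t).const_mul (-a)).exp).neg.div_const a).congr_deriv ?_
    simp only [id]
    field_simp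
  rw [intervalIntegral.integral_eq_sub_of_hasDerivAt (fun t _ => hd t)
    (Continuous.intervalIntegrable (by fun_prop) _ _)]
  simp only [mul_zero, Real.exp_zero]
  ring

lemma integral_exp_neg_mul_abs_sub {a s : ℝ} (ha : a ≠ 0) (hs : s ∈ Set.Icc 0 T) :
    ∫ t in (0 : ℝ)..T, Real.exp (-a * |s - t|) =
      (2 - Real.exp (-a * s) - Real.exp (-a * (T - s))) / a := by
  have hcont : Continuous fun t => Real.exp (-a * |s - t|) := by fun_prop
  have h1 : ∫ t in (0 : ℝ)..s, Real.exp (-a * |s - t|) = (1 - Real.exp (-a * s)) / a := by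
    rw [← integral_exp_neg_mul a ha s]
    have h := intervalIntegral.integral_comp_sub_left (a := 0) (b := s)
      (fun t => Real.exp (-a * t)) s
    rw [sub_self, sub_zero] at h
    rw [← h]
    refine intervalIntegral.integral_congr fun t ht => ?_
    rw [Set.uIcc_of_le hs.1] at ht
    rw [abs_of_nonneg (sub_nonneg.2 ht.2)]
  have h2 : ∫ t in s..T, Real.exp (-a * |s - t|) = (1 - Real.exp (-a * (T - s))) / a := by
    rw [← integral_exp_neg_mul a ha (T - s)]
    have h := intervalIntegral.integral_comp_sub_right (a := s) (b := T)
      (fun t => Real.exp (-a * t)) s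
    rw [sub_self] at h
    rw [← h]
    refine intervalIntegral.integral_congr fun t ht => ?_
    rw [Set.uIcc_of_le hs.2] at ht
    rw [abs_sub_comm, abs_of_nonneg (sub_nonneg.2 ht.1)]
  rw [← intervalIntegral.integral_add_adjacent_intervals (hcont.intervalIntegrable 0 s)
    (hcont.intervalIntegrable s T), h1, h2]
  ring

lemma integral_integral_autocorr_sq (hT : 0 < T) (hα : 0 < α) :
    ∫ s in (0 : ℝ)..T, ∫ t in (0 : ℝ)..T, autocorr P α (s - t) ^ 2 =
      P * (1 - psi (2 * α * T)) / α * (P * T) := by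
  have ha : 2 * α ≠ 0 := by positivity
  have hinner : ∀ s ∈ Set.uIcc 0 T, ∫ t in (0 : ℝ)..T, autocorr P α (s - t) ^ 2 =
      P ^ 2 * ((2 - Real.exp (-(2 * α) * s) - Real.exp (-(2 * α) * (T - s))) / (2 * α)) := by
    intro s hs
    rw [Set.uIcc_of_le hT.le] at hs
    rw [← integral_exp_neg_mul_abs_sub ha hs, ← intervalIntegral.integral_const_mul]
    refine intervalIntegral.integral_congr fun t _ => ?_
    simp only [autocorr]
    rw [mul_pow, ← Real.exp_nat_mul]
    congr 2; push_cast; ring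
  rw [intervalIntegral.integral_congr hinner, intervalIntegral.integral_const_mul,
    intervalIntegral.integral_div, intervalIntegral.integral_sub
      (Continuous.intervalIntegrable (by fun_prop) _ _)
      (Continuous.intervalIntegrable (by fun_prop) _ _),
    intervalIntegral.integral_sub
      (Continuous.intervalIntegrable (by fun_prop) _ _)
      (Continuous.intervalIntegrable (by fun_prop) _ _),
    intervalIntegral.integral_comp_sub_left (fun t => Real.exp (-(2 * α) * t)) T, sub_self,
    sub_zero, integral_exp_neg_mul _ ha, intervalIntegral.integral_const, psi, neg_mul]
  simp only [smul_eq_mul, sub_zero]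
  field_simp
  ring

lemma hasSum_eigenvalue (hT : 0 < T) (hα : 0 < α) (hP : 0 < P)
    (hω : ∀ k, IsResonantFrequency T α (k + 1) (ω k)) :
    HasSum (fun k => eigenvalue P α (ω k)) (P * T) := by
  have h := (isMercerExpansion hT hα hP hω).hasSum_integral_diag hT
    (summable_eigenvalue hT hα hω) fun k t _ => abs_eigenfunction_le hT hα (hω k) t
  simpa [autocorr, mul_comm] using h

lemma hasSum_eigenvalue_sq (hT : 0 < T) (hα : 0 < α) (hP : 0 < P)
    (hω : ∀ k, IsResonantFrequency T α (k + 1) (ω k)) :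
    HasSum (fun k => eigenvalue P α (ω k) ^ 2)
      (P * (1 - psi (2 * α * T)) / α * (P * T)) := by
  have h := (isMercerExpansion hT hα hP hω).hasSum_sq_integral (B := P) hT
    (summable_eigenvalue hT hα hω) (fun k t _ => abs_eigenfunction_le hT hα (hω k) t)
    (fun s => by unfold autocorr; fun_prop) fun s t => by
      rw [autocorr, abs_of_nonneg (by positivity)]
      refine mul_le_of_le_one_right hP.le (Real.exp_le_one_iff.2 ?_)
      rw [neg_mul]
      exact neg_nonpos.2 (by positivity)
  rwa [integral_integral_autocorr_sq hT hα] at h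

lemma summable_log_one_add_mul {lam : ℕ → ℝ} {c : ℝ} (hc : 0 < c) (hpos : ∀ k, 0 < lam k)
    (hlam : Summable lam) : Summable fun k => Real.log (1 + c * lam k) := by
  refine (hlam.mul_left c).of_nonneg_of_le (fun k => ?_) fun k => ?_
  · have := mul_pos hc (hpos k)
    exact Real.log_nonneg (by linarith)
  · have := mul_pos hc (hpos k)
    linarith [Real.log_le_sub_one_of_pos (by linarith : 0 < 1 + c * lam k)]

/-- Jensen's inequality for the convex function `x ↦ 2c / (2 + cx)`, a lower bound for
`log (1 + cx) / x`, with weights `lam k` and mean value `m`. -/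
lemma div_le_tsum_log_one_add {lam : ℕ → ℝ} {A c m : ℝ} (hc : 0 < c) (hm : 0 < m)
    (hpos : ∀ k, 0 < lam k) (h1 : HasSum lam A) (h2 : HasSum (fun k => lam k ^ 2) (m * A)) :
    2 * c * A / (2 + c * m) ≤ ∑' k, Real.log (1 + c * lam k) := by
  have hb : ∀ k, 2 * c / (2 + c * m) * lam k -
      2 * c ^ 2 / (2 + c * m) ^ 2 * (lam k ^ 2 - m * lam k) ≤ Real.log (1 + c * lam k) := by
    intro k
    have hk := hpos k
    have hck : 0 ≤ c * lam k := by positivity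
    refine le_trans ?_ (Real.le_log_one_add_of_nonneg hck)
    -- the tangent line at `m` lies below the convex function
    have hdiff : 2 * (c * lam k) / (c * lam k + 2) - (2 * c / (2 + c * m) * lam k -
        2 * c ^ 2 / (2 + c * m) ^ 2 * (lam k ^ 2 - m * lam k)) =
        2 * c ^ 3 * lam k * (lam k - m) ^ 2 / ((c * lam k + 2) * (2 + c * m) ^ 2) := by
      field_simp
      ring
    have hnn : 0 ≤ 2 * c ^ 3 * lam k * (lam k - m) ^ 2 / ((c * lam k + 2) * (2 + c * m) ^ 2) := by
      positivity
    linarith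
  have hsum := (h1.mul_left (2 * c / (2 + c * m))).sub
    ((h2.sub (h1.mul_left m)).mul_left (2 * c ^ 2 / (2 + c * m) ^ 2))
  have := hasSum_le hb hsum (summable_log_one_add_mul hc hpos h1.summable).hasSum
  refine le_trans (le_of_eq ?_) this
  ring

/-- The power threshold is exactly where the Jensen bound for the finite-time rate meets the
average rate. -/
lemma half_sqrt_sub_lt_div {u q : ℝ} (hα : 0 < α) (hu : 0 < u) (hq : 0 < q)
    (h : u * q ^ 2 < 2 * α * (1 - q)) :
    1 / 2 * (Real.sqrt (α ^ 2 + 2 * α * u) - α) < u / (2 + u * q / α) := by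
  have hD : 0 < 2 * α + u * q := by positivity
  have heq : u / (2 + u * q / α) = u * α / (2 * α + u * q) := by
    field_simp
  rw [heq]
  have hkey : Real.sqrt (α ^ 2 + 2 * α * u) < α + 2 * (u * α / (2 * α + u * q)) := by
    rw [Real.sqrt_lt' (by positivity)]
    have hdiff : (α + 2 * (u * α / (2 * α + u * q))) ^ 2 - (α ^ 2 + 2 * α * u) =
        2 * α * u ^ 2 * (2 * α * (1 - q) - u * q ^ 2) / (2 * α + u * q) ^ 2 := by
      field_simp
      ring
    have hpos : 0 < 2 * α * u ^ 2 * (2 * α * (1 - q) - u * q ^ 2) / (2 * α + u * q) ^ 2 := by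
      have := sub_pos.2 h
      positivity
    linarith
  linarith

lemma averageRate_lt_finiteTimeRate (hT : 0 < T) (hn₀ : 0 < n₀) (hα : 0 < α) (hP : 0 < P)
    (hω : ∀ k, IsResonantFrequency T α (k + 1) (ω k)) (hPδ : P < powerThreshold T n₀ α) :
    averageRate (psd (autocorr P α)) (fun _ => n₀ / 2) <
      finiteTimeRate T n₀ fun k => eigenvalue P α (ω k) := by
  have hq : 0 < 1 - psi (2 * α * T) := sub_pos.2 (psi_lt_one (by positivity))
  have hJ := div_le_tsum_log_one_add (c := 2 / n₀) (m := P * (1 - psi (2 * α * T)) / α)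
    (by positivity) (by positivity) (fun k => eigenvalue_pos hα hP (ω k))
    (hasSum_eigenvalue hT hα hP hω) (hasSum_eigenvalue_sq hT hα hP hω)
  have hlog : ∀ x, 1 + x / (n₀ / 2) = 1 + 2 / n₀ * x := fun x => by field_simp
  rw [averageRate_eq hα hn₀ hP, finiteTimeRate]
  simp_rw [hlog]
  have hlt := half_sqrt_sub_lt_div (u := 2 * P / n₀) (q := 1 - psi (2 * α * T)) hα
    (by positivity) hq (by
      rw [powerThreshold, lt_div_iff₀ (by positivity)] at hPδ
      rw [div_mul_eq_mul_div, div_lt_iff₀ hn₀]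
      linarith)
  have e1 : 2 * α * (2 * P / n₀) = 4 * P * α / n₀ := by ring
  rw [e1] at hlt
  refine hlt.trans_le ?_
  refine le_trans (le_of_eq ?_) (mul_le_mul_of_nonneg_left hJ (by positivity))
  field_simp

end FiniteTimeRate

end ExceedAverage

theorem theorem2 (T n₀ α : ℝ) (hT : 0 < T) (hn₀ : 0 < n₀) (hα : 0 < α) :
    -- for every `m ≥ 1` there is exactly one resonant frequency
    (∀ m : ℕ, 1 ≤ m → ∃! w : ℝ, ExceedAverage.IsResonantFrequency T α m w) ∧
    ∀ ω : ℕ → ℝ, (∀ k, ExceedAverage.IsResonantFrequency T α (k + 1) (ω k)) →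
      -- the eigenpairs and the average rate, for every power
      (∀ P : ℝ, 0 < P →
        ExceedAverage.IsMercerExpansion (fun s t => ExceedAverage.autocorr P α (s - t)) T
          (fun k => ExceedAverage.eigenvalue P α (ω k))
          (fun k => ExceedAverage.eigenfunction T α (ω k)) ∧
        Summable (fun k => Real.log (1 + ExceedAverage.eigenvalue P α (ω k) / (n₀ / 2))) ∧
        Integrable
          (fun f => Real.log (1 + ExceedAverage.psd (ExceedAverage.autocorr P α) f / (n₀ / 2))) ∧
        ExceedAverage.averageRate
            (ExceedAverage.psd (ExceedAverage.autocorr P α)) (fun _ => n₀ / 2) =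
          1 / 2 * (Real.sqrt (α ^ 2 + 4 * P * α / n₀) - α)) ∧
      -- the exceed-average inequality below an explicit power threshold
      ∃ δ : ℝ, δ = ExceedAverage.powerThreshold T n₀ α ∧ 0 < δ ∧
        ∀ P : ℝ, 0 < P → P < δ →
          ExceedAverage.finiteTimeRate T n₀ (fun k => ExceedAverage.eigenvalue P α (ω k)) >
            ExceedAverage.averageRate
              (ExceedAverage.psd (ExceedAverage.autocorr P α)) (fun _ => n₀ / 2) := by
  refine ⟨fun m hm => ?_, fun ω hω => ⟨fun P hP => ?_, _, rfl,
    ExceedAverage.powerThreshold_pos hT hn₀ hα, fun P hP hPδ =>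
      ExceedAverage.averageRate_lt_finiteTimeRate hT hn₀ hα hP hω hPδ⟩⟩
  · refine ⟨_, (ExceedAverage.isResonantFrequency_iff hT hα hm).2 rfl, fun w hw => ?_⟩
    exact ((ExceedAverage.isResonantFrequency_iff hT hα hm).1 hw).symm
  · refine ⟨ExceedAverage.isMercerExpansion hT hα hP hω, ?_,
      ExceedAverage.integrable_log_psd hα hn₀ hP, ExceedAverage.averageRate_eq hα hn₀ hP⟩
    have h := ExceedAverage.summable_log_one_add_mul (c := 2 / n₀) (by positivity)
      (fun k => ExceedAverage.eigenvalue_pos hα hP (ω k))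
      (ExceedAverage.summable_eigenvalue hT hα hω)
    refine h.congr fun k => ?_
    congr 2
    field_simp
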